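/- **Setting.** Let $T$ be an equilateral triangle in the Euclidean plane with edge length $e>0$ (a base triangle of the equilateral mesh). A boundary chain is an oriented polyline with vertices $P_i$ and segments $S_i=\overline{P_iP_{i+1}}$, $i$ in an interval of integers (finite for an open polyline; all of $\mathbb Z$, periodically, for a closed polygon). It satisfies the geometric protocol if (1) the angle $\angle P_iP_{i+1}P_{i+2}\in[0,\pi]$ between any two consecutive segments is at least $90^\circ$, and (2) every segment is longer than $e$. **Counting.** A segment $S$ has an event on an edge of $T$ if it crosses or ends on the edge at a single non-vertex point, or contains a vertex of the edge, or overlaps the edge collinearly. The count of $S$ is the number of edges of $T$ that carry an event (at most one event per edge, so a vertex of $T$ on $S$ counts for both incident edges). A configuration of the chain on $T$ is a maximal non-empty block of consecutive segments that all meet the closed triangle $T$. Its type is $(0,k)$ if it is a single segment of count $k$, and $(k,\ell)$ with $k\le\ell$ if it consists of two segments whose counts, in some order, are $k$ and $\ell$. **Templates.** A template is a type together with a finite list of triangular faces whose corners are labels among $A,B,C,P,Q_1,\dots,Q_4$. It retriangulates $T$ for a configuration if the labels it uses can be placed injectively so that $A,B,C$ go to the vertices of $T$ in some order, $P$ (if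 used) to an endpoint in $T$ of a segment of the configuration, each used $Q_j$ to a point which is the whole intersection of a segment of the configuration with an edge of $T$; the points used are exactly the vertices of $T$, all such intersection points and all endpoints in $T$; the faces become non-degenerate triangles with union $T$, any two of which meet exactly in the convex hull of their common corners; and the part in $T$ of every segment of the configuration is a union of vertices and edges of these triangles. The lookup table consists of the following templates. - $(0,1)$: $\{CPB, PAB\}$; $\{APQ_1, CQ_1P, CPB, ABP\}$. - $(0,2)$: $\{ABC\}$; $\{Q_2Q_1C, Q_2AB, Q_1Q_2B\}$; $\{ABP, BCP\}$; $\{CAP, ABP, CPB\}$. - $(0,3)$: $\{AQ_1C, ABQ_1\}$; $\{ABC\}$. - $(1,1)$: $\{Q_1PC, PQ_2C, Q_1AP, ABP, Q_2PB\}$; $\{CPB, PAB\}$; $\{Q_1PC, PQ_1Q_2, Q_2AP, BCP, ABP\}$. - $(1,2)$: $\{CAP, ABP, CPQ_1, PBQ_1\}$; $\{APQ_1, CQ_1P, CPB, ABP\}$; $\{APC, AQ_1P, BPQ_1, BCP\}$; $\{ABP, BCP\}$; $\{PQ_1C, BQ_1P, ABP\}$; $\{PAQ_1, Q_1BP, BCP\}$.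 - $(2,2)$: $\{CAP, ABP, CPB\}$; $\{Q_1Q_2A, Q_1Q_4Q_2, Q_1Q_3Q_4, Q_1BQ_3, Q_4Q_3C\}$; $\{AQ_1P, PQ_2C, PQ_1Q_2, Q_1BQ_2\}$; $\{BCP, ABP\}$; $\{PQ_1C, BQ_1P, ABP\}$; $\{PAQ_1, Q_1BP, BCP\}$; $\{AQ_2Q_1, Q_2BQ_1, Q_1BC\}$; $\{ABC\}$; $\{PQ_1C, PQ_2Q_1, PAB, PBQ_2\}$; $\{AQ_1P, Q_1Q_2P, PQ_2B, PBC\}$; $\{ABQ_2, Q_2BQ_4, Q_1Q_2Q_4, Q_1Q_4Q_3, Q_1Q_3C\}$; $\{Q_3Q_1A, Q_4Q_1Q_3, Q_1Q_4Q_2, Q_2Q_4B, Q_2BC\}$. - $(1,3)$: $\{ABP, PBC\}$. - $(2,3)$: $\{ABP, PBC\}$; $\{ABQ_1, AQ_1C\}$; $\{ABC\}$; $\{AQ_1P, PBC, PQ_1B\}$; $\{ABP, PBQ_1, PQ_1C\}$; $\{ABQ_1, Q_1BQ_3, Q_1Q_3Q_2, Q_2Q_3C\}$. **Theorem.** Let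 $T$ be a base triangle with edge length $e$, and let a boundary chain satisfy the geometric protocol. Then: 1. Every segment of the chain that meets $T$ belongs to a configuration of the chain on $T$, and every configuration consists of one segment or of two consecutive segments. 2. The type of every configuration is one of $$(0,1),\ (0,2),\ (0,3),\ (1,1),\ (1,2),\ (2,2),\ (1,3),\ (2,3),$$ and the lookup table contains a template of this type that retriangulates $T$ for the configuration. 3. Each of these eight types has at least one template in the lookup table. -/

import Mathlib

namespace SBMT

noncomputable section

/-- The Euclidean plane. -/
abbrev Plane : Type := EuclideanSpace ℝ (Fin 2)

/-! ## Base triangles, segments and boundary chains -/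

/-- A triangle of the equilateral base mesh: vertices `A = vertex 0`, `B = vertex 1`,
`C = vertex 2`, all three sides of the common mesh edge length `edgeLength`. -/
structure BaseTriangle where
  vertex : Fin 3 → Plane
  edgeLength : ℝ
  edgeLength_pos : 0 < edgeLength
  equilateral : ∀ i j, i ≠ j → dist (vertex i) (vertex j) = edgeLength

/-- The closed triangle. -/
def BaseTriangle.carrier (T : BaseTriangle) : Set Plane :=
  convexHull ℝ (Set.range T.vertex)

/-- The closed edges `AB`, `BC`, `CA` (indices `0`, `1`, `2`; addition is modulo 3). -/
def BaseTriangle.edge (T : BaseTriangle) (i : Fin 3) : Set Plane :=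
  segment ℝ (T.vertex i) (T.vertex (i + 1))

/-- A boundary segment, given by its two endpoints. -/
structure BoundarySegment where
  source : Plane
  target : Plane

/-- The closed segment as a point set. -/
def BoundarySegment.carrier (S : BoundarySegment) : Set Plane :=
  segment ℝ S.source S.target

/-- The segment meets the closed triangle. -/
def BaseTriangle.Meets (T : BaseTriangle) (S : BoundarySegment) : Prop :=
  (S.carrier ∩ T.carrier).Nonempty

/-- An oriented polygonal boundary chain: for every `i` in an interval `index` of integers, the
`i`-th segment runs from `vertex i` to `vertex (i + 1)`. A finite open polyline with `n` segments
has `index = {0, …, n - 1}`; a closed polygon with `n` sides is the `n`-periodic chain with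
`index = ℤ`. -/
structure BoundaryChain where
  index : Set ℤ
  interval : index.OrdConnected
  vertex : ℤ → Plane

/-- The `i`-th segment of the chain. -/
def BoundaryChain.side (Γ : BoundaryChain) (i : ℤ) : BoundarySegment :=
  ⟨Γ.vertex i, Γ.vertex (i + 1)⟩

/-- The geometric protocol relative to a base mesh of edge length `e`:
(1) consecutive segments enclose an angle of at least `90°`;
(2) every segment is longer than the mesh edge. -/
structure BoundaryChain.GeometricProtocol (Γ : BoundaryChain) (e : ℝ) : Prop where
  angular : ∀ i, i ∈ Γ.index → i + 1 ∈ Γ.index →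
    Real.pi / 2 ≤ EuclideanGeometry.angle (Γ.vertex i) (Γ.vertex (i + 1)) (Γ.vertex (i + 2))
  length : ∀ i, i ∈ Γ.index → e < dist (Γ.vertex i) (Γ.vertex (i + 1))

/-! ## The counting rule -/

/-- The counting rule records an event of the segment `S` on the edge `i` of `T` if
* `S` crosses the edge, or ends on it, at a single point which is not a vertex, or
* a vertex of the edge lies on `S` (so that a vertex of `T` on `S` gives an event on both edges
  incident to it), or
* `S` overlaps the edge collinearly. -/
def EdgeEvent (T : BaseTriangle) (S : BoundarySegment) (i : Fin 3) : Prop :=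
  (∃ x, x ≠ T.vertex i ∧ x ≠ T.vertex (i + 1) ∧ S.carrier ∩ T.edge i = {x}) ∨
  (T.vertex i ∈ S.carrier ∨ T.vertex (i + 1) ∈ S.carrier) ∨
  (S.carrier ∩ T.edge i).Nontrivial

/-- The number of intersections contributed by `S` on the boundary of `T`: one for each edge of `T`
that carries an event. -/
def intersectionCount (T : BaseTriangle) (S : BoundarySegment) : ℕ :=
  Set.ncard {i : Fin 3 | EdgeEvent T S i}

/-! ## Local configurations of a chain on a triangle -/

/-- The segments `a, a + 1, …, a + m - 1` of the chain form a maximal (non-empty) block of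
consecutive segments all of which meet `T`. -/
structure IsRun (T : BaseTriangle) (Γ : BoundaryChain) (a : ℤ) (m : ℕ) : Prop where
  pos : 0 < m
  meets : ∀ j : ℤ, a ≤ j → j < a + m → j ∈ Γ.index ∧ T.Meets (Γ.side j)
  left_maximal : ¬ (a - 1 ∈ Γ.index ∧ T.Meets (Γ.side (a - 1)))
  right_maximal : ¬ (a + m ∈ Γ.index ∧ T.Meets (Γ.side (a + m)))

/-- The list of the segments `a, a + 1, …, a + m - 1`, in the order of the chain. -/
def configuration (Γ : BoundaryChain) (a : ℤ) (m : ℕ) : List BoundarySegment :=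
  (List.range m).map fun j => Γ.side (a + (j : ℤ))

/-- The pair of counts of the (first two) segments of a configuration; a single segment is
paired with `0`. -/
def countPair (T : BaseTriangle) : List BoundarySegment → ℕ × ℕ
  | [] => (0, 0)
  | [S] => (0, intersectionCount T S)
  | S₁ :: S₂ :: _ => (intersectionCount T S₁, intersectionCount T S₂)

/-- The type `(k, ℓ)`, `k ≤ ℓ`, of a configuration: the pair of counts up to reversal of the
orientation of the chain. -/
def configurationType (T : BaseTriangle) (c : List BoundarySegment) : ℕ × ℕ :=
  (min (countPair T c).1 (countPair T c).2, max (countPair T c).1 (countPair T c).2)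

/-- The canonical types. -/
def canonicalTypes : List (ℕ × ℕ) :=
  [(0, 1), (0, 2), (0, 3), (1, 1), (1, 2), (2, 2), (1, 3), (2, 3)]

/-! ## The points embedded by a configuration -/

/-- The isolated intersection points of the segments with the edges of `T`. -/
def crossingPoints (T : BaseTriangle) (c : List BoundarySegment) : Set Plane :=
  {x | ∃ S ∈ c, ∃ i, S.carrier ∩ T.edge i = {x}}

/-- The endpoints of the segments that lie in the closed triangle. -/
def endPoints (T : BaseTriangle) (c : List BoundarySegment) : Set Plane :=
  {x | x ∈ T.carrier ∧ ∃ S ∈ c, x = S.source ∨ x = S.target}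

/-! ## Retriangulation templates -/

/-- The vertex labels of templates: the vertices `A`, `B`, `C` of the triangle, an endpoint `P`
of a boundary segment, and intersection points `Q1, …, Q4` on the edges. -/
inductive Label where
  | A | B | C | P | Q1 | Q2 | Q3 | Q4
  deriving DecidableEq

/-- A template: the type under which it is filed, and its list of triangular faces. -/
structure Template where
  type : ℕ × ℕ
  faces : List (Label × Label × Label)

/-- The three labels of a face. -/
def faceLabels (f : Label × Label × Label) : Set Label := {f.1, f.2.1, f.2.2}

/-- The labels used by a template. -/
def Template.labels (τ : Template) : Set Label := {l | ∃ f ∈ τ.faces, l ∈ faceLabels f}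

/-- The sub-triangle obtained from a face by placing the labels in the plane. -/
def faceHull (π : Label → Plane) (f : Label × Label × Label) : Set Plane :=
  convexHull ℝ (π '' faceLabels f)

/-- `π` places the labels of `τ` at the points which the configuration `c` induces on `T`:
`A, B, C` go to the vertices of `T` (in some order, i.e. up to a rotation or reflection of `T`),
`P` goes to an endpoint of a segment in `T`, the `Qⱼ` to intersection points on the edges;
distinct labels go to distinct points, and the points used are exactly the vertices of `T`,
the intersection points and the endpoints in `T`. -/
structure Template.Placement (τ : Template) (T : BaseTriangle) (c : List BoundarySegment)
    (π : Label → Plane) : Prop where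
  vertices : ∃ s : Equiv.Perm (Fin 3),
    π .A = T.vertex (s 0) ∧ π .B = T.vertex (s 1) ∧ π .C = T.vertex (s 2)
  endpoint : .P ∈ τ.labels → π .P ∈ endPoints T c
  crossing : ∀ q ∈ ({.Q1, .Q2, .Q3, .Q4} : Set Label), q ∈ τ.labels → π q ∈ crossingPoints T c
  injective : Set.InjOn π τ.labels
  points : π '' τ.labels = Set.range T.vertex ∪ crossingPoints T c ∪ endPoints T c

/-- The template `τ` retriangulates `T` for the configuration `c`: for a suitable placement of the
labels its faces are non-degenerate triangles which tile `T` face to face (any two of them meet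
exactly in the convex hull of their common vertices), and the part in `T` of every segment of `c`
is a union of vertices and edges of these triangles. -/
def Template.Retriangulates (τ : Template) (T : BaseTriangle) (c : List BoundarySegment) : Prop :=
  ∃ π : Label → Plane, τ.Placement T c π ∧
    (∀ f ∈ τ.faces, AffineIndependent ℝ ![π f.1, π f.2.1, π f.2.2]) ∧
    (⋃ f ∈ τ.faces, faceHull π f) = T.carrier ∧
    (∀ f ∈ τ.faces, ∀ g ∈ τ.faces, f ≠ g →
      faceHull π f ∩ faceHull π g = convexHull ℝ (π '' faceLabels f ∩ π '' faceLabels g)) ∧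
    (∀ S ∈ c, ∀ x ∈ S.carrier ∩ T.carrier, ∃ f ∈ τ.faces, ∃ u ∈ faceLabels f,
      ∃ v ∈ faceLabels f, x ∈ segment ℝ (π u) (π v) ∧ segment ℝ (π u) (π v) ⊆ S.carrier)

open Label in
/-- The lookup table. Each entry is a type together with a list of faces. -/
def lookupTable : List Template :=
  [ -- one segment
    ⟨(0, 1), [(C, P, B), (P, A, B)]⟩,
    ⟨(0, 1), [(A, P, Q1), (C, Q1, P), (C, P, B), (A, B, P)]⟩,
    ⟨(0, 2), [(A, B, C)]⟩,
    ⟨(0, 2), [(Q2, Q1, C), (Q2, A, B), (Q1, Q2, B)]⟩,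
    ⟨(0, 2), [(A, B, P), (B, C, P)]⟩,
    ⟨(0, 2), [(C, A, P), (A, B, P), (C, P, B)]⟩,
    ⟨(0, 3), [(A, Q1, C), (A, B, Q1)]⟩,
    ⟨(0, 3), [(A, B, C)]⟩,
    -- two consecutive segments
    ⟨(1, 1), [(Q1, P, C), (P, Q2, C), (Q1, A, P), (A, B, P), (Q2, P, B)]⟩,
    ⟨(1, 1), [(C, P, B), (P, A, B)]⟩,
    ⟨(1, 1), [(Q1, P, C), (P, Q1, Q2), (Q2, A, P), (B, C, P), (A, B, P)]⟩,
    ⟨(1, 2), [(C, A, P), (A, B, P), (C, P, Q1), (P, B, Q1)]⟩,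
    ⟨(1, 2), [(A, P, Q1), (C, Q1, P), (C, P, B), (A, B, P)]⟩,
    ⟨(1, 2), [(A, P, C), (A, Q1, P), (B, P, Q1), (B, C, P)]⟩,
    ⟨(1, 2), [(A, B, P), (B, C, P)]⟩,
    ⟨(1, 2), [(P, Q1, C), (B, Q1, P), (A, B, P)]⟩,
    ⟨(1, 2), [(P, A, Q1), (Q1, B, P), (B, C, P)]⟩,
    ⟨(2, 2), [(C, A, P), (A, B, P), (C, P, B)]⟩,
    ⟨(2, 2), [(Q1, Q2, A), (Q1, Q4, Q2), (Q1, Q3, Q4), (Q1, B, Q3), (Q4, Q3, C)]⟩,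
    ⟨(2, 2), [(A, Q1, P), (P, Q2, C), (P, Q1, Q2), (Q1, B, Q2)]⟩,
    ⟨(2, 2), [(B, C, P), (A, B, P)]⟩,
    ⟨(2, 2), [(P, Q1, C), (B, Q1, P), (A, B, P)]⟩,
    ⟨(2, 2), [(P, A, Q1), (Q1, B, P), (B, C, P)]⟩,
    ⟨(2, 2), [(A, Q2, Q1), (Q2, B, Q1), (Q1, B, C)]⟩,
    ⟨(2, 2), [(A, B, C)]⟩,
    ⟨(2, 2), [(P, Q1, C), (P, Q2, Q1), (P, A, B), (P, B, Q2)]⟩,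
    ⟨(2, 2), [(A, Q1, P), (Q1, Q2, P), (P, Q2, B), (P, B, C)]⟩,
    ⟨(2, 2), [(A, B, Q2), (Q2, B, Q4), (Q1, Q2, Q4), (Q1, Q4, Q3), (Q1, Q3, C)]⟩,
    ⟨(2, 2), [(Q3, Q1, A), (Q4, Q1, Q3), (Q1, Q4, Q2), (Q2, Q4, B), (Q2, B, C)]⟩,
    ⟨(2, 3), [(A, B, P), (P, B, C)]⟩,
    ⟨(2, 3), [(A, B, Q1), (A, Q1, C)]⟩,
    ⟨(2, 3), [(A, B, C)]⟩,
    ⟨(2, 3), [(A, Q1, P), (P, B, C), (P, Q1, B)]⟩,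
    ⟨(2, 3), [(A, B, P), (P, B, Q1), (P, Q1, C)]⟩,
    ⟨(2, 3), [(A, B, Q1), (Q1, B, Q3), (Q1, Q3, Q2), (Q2, Q3, C)]⟩,
    ⟨(1, 3), [(A, B, P), (P, B, C)]⟩ ]

end

end SBMT

/-!
The points of a base triangle are described by barycentric coordinates, and a segment `S` is
described by its trace `S ∩ T`, which is a segment `[x, y]`. An edge of `T` carries an event exactly
if `S` meets it, so the count of `S` is the number of sides containing `x` or `y` (`count_trace`),
and the isolated intersection points and the endpoints of `S` in `T` are among `x` and `y`. Hence a
template retriangulates `T` as soon as its faces tile `T`, its labels sit at the right points, and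
each trace is one of its edges (`retriangulates_of_tiles`).

All templates in use arise from three triangulations of a triangle (the trivial one, the one by an
interior point and the one by a point on each side) by splitting boundary edges
(`Tiles.split_edge`). This operation preserves face-to-face tilings, so no template needs a
computation of its own.

The metric hypotheses enter as follows. The diameter of `T` is its edge length.
* Of three consecutive segments the first and the last lie in half planes whose distance is the
  length of the middle one, so they do not both meet `T` (`not_meets_both`), and configurations
  have one or two segments.
* A segment has at most one endpoint in `T`, which leaves the list of single traces in
  `covered_of_exits` and `covered_of_crossing`.
* If two consecutive segments share a point `p` of `T`, they leave it in directions enclosing at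
  least a right angle. If `p` is a vertex, where the angle of `T` is `60°`, one of them leaves `T`
  at once, and in general they do not run together (`covered_pair_of_exits`).
* If `p` lies outside `T` and both segments meet `T`, then `T` is seen from `p` at an angle of at
  least `90°`. This places `p` beyond exactly one side, strictly between the lines of the other two
  (`exists_frame_of_outside`), and neither segment ends in `T`. The two rays from `p` enter through
  that side in an order determined by where they leave (`covered_of_outside`).
-/

namespace SBMT

/-! ### Triangles in the plane -/

theorem mem_convexHull_triple {x y z p : Plane} :
    p ∈ convexHull ℝ ({x, y, z} : Set Plane) ↔
      ∃ a b c : ℝ, 0 ≤ a ∧ 0 ≤ b ∧ 0 ≤ c ∧ a + b + c = 1 ∧ a • x + b • y + c • z = p := by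
  rw [convexHull_insert (by simp), convexHull_pair]
  simp only [mem_convexJoin, Set.mem_singleton_iff, exists_eq_left]
  constructor
  · rintro ⟨q, ⟨b, c, hb, hc, hbc, rfl⟩, ⟨s, t, hs, ht, hst, rfl⟩⟩
    refine ⟨s, t * b, t * c, hs, by positivity, by positivity, ?_, by module⟩
    rw [add_assoc, ← mul_add, hbc, mul_one, hst]
  · rintro ⟨a, b, c, ha, hb, hc, h, rfl⟩
    rcases (add_nonneg hb hc).eq_or_lt with h0 | h0
    · obtain rfl : b = 0 := by linarith
      obtain rfl : c = 0 := by linarith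
      exact ⟨y, left_mem_segment ℝ y z, 1, 0, by norm_num, le_rfl, by norm_num, by
        rw [show a = 1 by linarith]; module⟩
    · refine ⟨(b / (b + c)) • y + (c / (b + c)) • z,
        ⟨b / (b + c), c / (b + c), by positivity, by positivity, by field_simp, rfl⟩,
        a, b + c, ha, h0.le, by linarith, ?_⟩
      rw [smul_add, smul_smul, smul_smul, mul_div_cancel₀ _ h0.ne', mul_div_cancel₀ _ h0.ne',
        add_assoc]

theorem not_collinear_iff {x y z : Plane} :
    ¬ Collinear ℝ ({x, y, z} : Set Plane) ↔
      ∀ a b c : ℝ, a + b + c = 0 → a • x + b • y + c • z = 0 → a = 0 ∧ b = 0 ∧ c = 0 := by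
  rw [← affineIndependent_iff_not_collinear_set]
  constructor
  · intro h a b c hs hc
    have := affineIndependent_iff.1 h Finset.univ ![a, b, c]
      (by simpa [Fin.sum_univ_three] using hs) (by simpa [Fin.sum_univ_three] using hc)
    exact ⟨this 0 (by simp), this 1 (by simp), this 2 (by simp)⟩
  · intro h
    rw [affineIndependent_iff_of_fintype]
    intro w hw hv
    rw [Finset.univ.weightedVSub_eq_linear_combination hw] at hv
    simp only [Fin.sum_univ_three] at hw hv
    obtain ⟨h0, h1, h2⟩ := h _ _ _ hw hv
    intro i
    fin_cases i
    exacts [h0, h1, h2]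

/-- Barycentric coordinates with respect to a non-degenerate triangle are unique. -/
theorem eq_of_not_collinear {x y z : Plane} (h : ¬ Collinear ℝ ({x, y, z} : Set Plane))
    {a b c a' b' c' : ℝ} (hs : a + b + c = 1) (hs' : a' + b' + c' = 1)
    (he : a • x + b • y + c • z = a' • x + b' • y + c' • z) : a = a' ∧ b = b' ∧ c = c' := by
  have := not_collinear_iff.1 h (a - a') (b - b') (c - c') (by linarith) (by
    rw [← sub_eq_zero.2 he]; module)
  exact ⟨by linarith [this.1], by linarith [this.2.1], by linarith [this.2.2]⟩

/-! ### Labelled triangulations -/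

/-- The convex hull of the points carrying the labels in `F`. -/
noncomputable def hull (π : Label → Plane) (F : Finset Label) : Set Plane :=
  convexHull ℝ (π '' (F : Set Label))

theorem hull_mono (π : Label → Plane) {F G : Finset Label} (h : F ⊆ G) : hull π F ⊆ hull π G :=
  convexHull_mono (Set.image_mono (by exact_mod_cast h))

theorem image_triple (π : Label → Plane) (x y z : Label) :
    π '' (({x, y, z} : Finset Label) : Set Label) = {π x, π y, π z} := by
  simp [Set.image_insert_eq]

theorem hull_triple (π : Label → Plane) (x y z : Label) :
    hull π {x, y, z} = convexHull ℝ {π x, π y, π z} := by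
  rw [hull, image_triple]

theorem hull_pair (π : Label → Plane) (x y : Label) : hull π {x, y} = segment ℝ (π x) (π y) := by
  simp [hull, Set.image_insert_eq, convexHull_pair]

theorem hull_singleton (π : Label → Plane) (x : Label) : hull π {x} = {π x} := by
  simp [hull]

theorem mem_hull_of_mem (π : Label → Plane) {F : Finset Label} {x : Label} (h : x ∈ F) :
    π x ∈ hull π F :=
  subset_convexHull _ _ ⟨x, h, rfl⟩

/-- The faces in `K`, sets of labels placed in the plane by `π`, are non-degenerate triangles which
tile `X` face to face. Faces are unordered, and they are intersected as sets of labels: that two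
labels are not placed at the same point is a consequence, `Tiles.injOn`. -/
structure Tiles (π : Label → Plane) (K : Finset (Finset Label)) (X : Set Plane) : Prop where
  triple : ∀ F ∈ K, ∃ x y z, F = {x, y, z}
  indep : ∀ F ∈ K, ¬ Collinear ℝ (π '' (F : Set Label))
  cover : (⋃ F ∈ K, hull π F) = X
  inter : ∀ F ∈ K, ∀ G ∈ K, F ≠ G → hull π F ∩ hull π G ⊆ hull π (F ∩ G)

/-- The only vertices of a triangle lying on one of its faces are the vertices of that face. -/
theorem mem_of_mem_hull {π : Label → Plane} {F : Finset Label} (hF : ∃ x y z, F = {x, y, z})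
    (h : ¬ Collinear ℝ (π '' (F : Set Label))) {G : Finset Label} {w : Label}
    (hw : w ∈ F) (hG : G ⊆ F) (hwG : π w ∈ hull π G) : w ∈ G := by
  -- The vertices other than `w` lie on a side, which does not contain `w`.
  by_contra hn
  have key : ∀ x y z, F = {x, y, z} → w = x → False := by
    rintro x y z rfl rfl
    rw [image_triple] at h
    have hsub : G ⊆ {y, z} := fun g hg => by
      have := hG hg
      simp only [Finset.mem_insert, Finset.mem_singleton] at this ⊢
      rcases this with rfl | h | h
      · exact absurd hg hn
      · exact Or.inl h
      · exact Or.inr h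
    have := hull_mono π hsub hwG
    rw [hull_pair] at this
    exact h (collinear_insert_of_mem_affineSpan_pair
      (mem_segment_iff_wbtw.1 this).mem_affineSpan)
  obtain ⟨x, y, z, rfl⟩ := hF
  have := hw
  simp only [Finset.mem_insert, Finset.mem_singleton] at this
  rcases this with h | h | h
  · exact key x y z rfl h
  · exact key y x z (Finset.insert_comm _ _ _) h
  · exact key z x y (by ext; simp; tauto) h

/-- In a triangulation distinct labels sit at distinct points. -/
theorem Tiles.injOn {π : Label → Plane} {K : Finset (Finset Label)} {X : Set Plane}
    (h : Tiles π K X) : Set.InjOn π {l | ∃ F ∈ K, l ∈ F} := by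
  have key : ∀ F ∈ K, ∀ v ∈ F, ∀ w ∈ F, π v = π w → v = w := fun F hF v hv w hw e => by
    have := mem_of_mem_hull (h.triple F hF) (h.indep F hF) (G := {w}) hv (by simpa using hw)
      (by simp [hull_singleton, e])
    simpa using this
  rintro v ⟨F, hF, hv⟩ w ⟨G, hG, hw⟩ e
  by_cases hFG : F = G
  · subst hFG
    exact key F hF v hv w hw e
  · have := h.inter F hF G hG hFG ⟨mem_hull_of_mem π hv, e ▸ mem_hull_of_mem π hw⟩
    have := mem_of_mem_hull (h.triple F hF) (h.indep F hF) hv Finset.inter_subset_left this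
    exact key G hG v (Finset.mem_inter.1 this).2 w hw e

theorem not_collinear_of_mem_openSegment {x y z q : Plane}
    (h : ¬ Collinear ℝ ({x, y, z} : Set Plane)) (hq : q ∈ openSegment ℝ x y) :
    ¬ Collinear ℝ ({x, q, z} : Set Plane) := by
  obtain ⟨s, t, hs, ht, hst, rfl⟩ := hq
  rw [not_collinear_iff] at h ⊢
  intro a b c h0 h1
  obtain ⟨h2, h3, h4⟩ := h (a + b * s) (b * t) c (by linear_combination h0 + b * hst)
    (by rw [← h1]; module)
  have hb : b = 0 := by simpa [ht.ne'] using h3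
  subst hb
  exact ⟨by linarith, rfl, h4⟩

/-- A point of a side splits a triangle into two triangles. -/
theorem convexHull_split {x y z q : Plane} (hq : q ∈ openSegment ℝ x y) :
    convexHull ℝ {x, y, z} = convexHull ℝ {x, q, z} ∪ convexHull ℝ ({q, y, z} : Set Plane) := by
  have hq' : q ∈ convexHull ℝ {x, y, z} :=
    segment_subset_convexHull (by simp) (by simp) (openSegment_subset_segment _ _ _ hq)
  have hx : ∀ w ∈ ({x, y, z} : Set Plane), w ∈ convexHull ℝ {x, y, z} := fun w hw =>
    subset_convexHull _ _ hw
  apply Set.Subset.antisymm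
  · obtain ⟨s, t, hs, ht, hst, rfl⟩ := hq
    intro p hp
    obtain ⟨a, b, c, ha, hb, hc, h1, rfl⟩ := mem_convexHull_triple.1 hp
    rcases le_total (b * s) (a * t) with h | h
    · refine Or.inl (mem_convexHull_triple.2 ⟨a - b / t * s, b / t, c, ?_, by positivity, hc, ?_, ?_⟩)
      · rw [sub_nonneg, div_mul_eq_mul_div, div_le_iff₀ ht]; exact h
      · field_simp; linear_combination t * h1 - b * hst
      · match_scalars <;> field_simp
        ring
    · refine Or.inr (mem_convexHull_triple.2 ⟨a / s, b - a / s * t, c, by positivity, ?_, hc, ?_, ?_⟩)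
      · rw [sub_nonneg, div_mul_eq_mul_div, div_le_iff₀ hs]; exact h
      · field_simp; linear_combination s * h1 - a * hst
      · match_scalars <;> field_simp
        ring
  · apply Set.union_subset <;> refine convexHull_min ?_ (convex_convexHull ℝ _) <;>
      rintro w (rfl | rfl | rfl) <;> first | exact hq' | exact hx _ (by simp)

theorem convexHull_split_inter {x y z q : Plane} (h : ¬ Collinear ℝ ({x, y, z} : Set Plane))
    (hq : q ∈ openSegment ℝ x y) :
    convexHull ℝ {x, q, z} ∩ convexHull ℝ ({q, y, z} : Set Plane) ⊆ segment ℝ q z := by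
  obtain ⟨s, t, hs, ht, hst, rfl⟩ := hq
  rintro p ⟨hp, hp'⟩
  obtain ⟨a, b, c, ha, hb, hc, h1, rfl⟩ := mem_convexHull_triple.1 hp
  obtain ⟨a', b', c', ha', hb', hc', h1', he⟩ := mem_convexHull_triple.1 hp'
  obtain ⟨e1, e2, e3⟩ := eq_of_not_collinear h (a := a + b * s) (b := b * t) (c := c)
    (a' := a' * s) (b' := a' * t + b') (c' := c') (by linear_combination h1 + b * hst)
    (by linear_combination h1' + a' * hst) (by
      refine Eq.trans ?_ (he.symm.trans ?_) <;> module)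
  have hba : a' ≤ b := le_of_mul_le_mul_right (by linarith) ht
  have hab : b ≤ a' := le_of_mul_le_mul_right (by linarith) hs
  obtain rfl : a' = b := le_antisymm hba hab
  obtain rfl : a = 0 := by linarith
  exact ⟨a', c, ha', hc, by linarith, by module⟩

/-- Splitting a boundary edge `x y` of a triangulation at an interior point `q` of the edge. That
only one face contains the edge is what keeps the triangulation face to face. -/
theorem Tiles.split_edge {π : Label → Plane} {K : Finset (Finset Label)} {X : Set Plane}
    (h : Tiles π K X) (x y z q : Label) (hq : π q ∈ openSegment ℝ (π x) (π y))
    (hF : {x, y, z} ∈ K := by decide)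
    (hb : ∀ G ∈ K, x ∈ G → y ∈ G → G = {x, y, z} := by decide) :
    Tiles π (insert {x, q, z} (insert {q, y, z} (K.erase {x, y, z}))) X := by
  have hn : ¬ Collinear ℝ ({π x, π y, π z} : Set Plane) := by
    simpa only [image_triple] using h.indep _ hF
  have hq' : π q ∈ openSegment ℝ (π y) (π x) := openSegment_symm ℝ (π x) (π y) ▸ hq
  have hn' : ¬ Collinear ℝ ({π y, π x, π z} : Set Plane) := by rwa [Set.insert_comm]
  -- A new face meets the other faces of the complex along common faces.
  have key : ∀ x y : Label, {x, y, z} ∈ K → (∀ G ∈ K, x ∈ G → y ∈ G → G = {x, y, z}) →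
      ¬ Collinear ℝ ({π x, π y, π z} : Set Plane) → π q ∈ openSegment ℝ (π x) (π y) →
      ∀ G ∈ K.erase {x, y, z},
        hull π {x, q, z} ∩ hull π G ⊆ hull π ({x, q, z} ∩ G) := by
    intro x y hF hb hn hq G hG p ⟨hp, hpG⟩
    obtain ⟨hne, hG⟩ := Finset.mem_erase.1 hG
    have hpF : p ∈ hull π {x, y, z} := by
      rw [hull_triple, convexHull_split hq, ← hull_triple]
      exact Or.inl hp
    have hpi := h.inter _ hF G hG hne.symm ⟨hpF, hpG⟩
    by_cases hy : y ∈ G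
    · have hx : x ∉ G := fun hx => hne (hb G hG hx hy)
      have : p ∈ hull π {y, z} := hull_mono π (fun l hl => by
        simp only [Finset.mem_inter, Finset.mem_insert, Finset.mem_singleton] at hl ⊢
        rcases hl with ⟨rfl | h | h, h'⟩
        · exact absurd h' hx
        · exact Or.inl h
        · exact Or.inr h) hpi
      rw [hull_pair] at this
      obtain ⟨b', c', hb', hc', hs', he'⟩ := this
      rw [hull_triple] at hp
      obtain ⟨a, b, c, ha, hb, hc, hs, he⟩ := mem_convexHull_triple.1 hp
      obtain ⟨s, t, hs0, ht0, hst, e⟩ := hq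
      obtain ⟨e1, e2, e3⟩ := eq_of_not_collinear hn (a := a + b * s) (b := b * t) (c := c)
        (a' := 0) (b' := b') (c' := c') (by linear_combination hs + b * hst)
        (by linarith) (by
          refine Eq.trans ?_ (he.trans (he'.symm.trans ?_))
          · rw [← e]; module
          · module)
      have hb0 : b = 0 := by
        have : b * s ≤ 0 := by linarith
        by_contra hne
        exact absurd (mul_pos (lt_of_le_of_ne hb (Ne.symm hne)) hs0) (by linarith)
      subst hb0
      have : c = 1 := by linarith [e1]
      subst this
      have hpz : p = π z := by rw [← he, show a = 0 by linarith]; module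
      have hz : z ∈ {x, y, z} ∩ G :=
        mem_of_mem_hull (h.triple _ hF) (h.indep _ hF) (by simp) Finset.inter_subset_left (hpz ▸ hpi)
      rw [hpz]
      exact mem_hull_of_mem π (Finset.mem_inter.2 ⟨by simp, (Finset.mem_inter.1 hz).2⟩)
    · refine hull_mono π (fun l hl => ?_) hpi
      simp only [Finset.mem_inter, Finset.mem_insert, Finset.mem_singleton] at hl ⊢
      rcases hl with ⟨h | rfl | h, h'⟩
      · exact ⟨Or.inl h, h'⟩
      · exact absurd h' hy
      · exact ⟨Or.inr (Or.inr h), h'⟩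
  have hswap : ({y, x, z} : Finset Label) = {x, y, z} := Finset.insert_comm _ _ _
  have hswap' : ({y, q, z} : Finset Label) = {q, y, z} := Finset.insert_comm _ _ _
  have k1 := key x y hF hb hn hq
  have k2 := key y x (hswap ▸ hF) (fun G hG h1 h2 => (hb G hG h2 h1).trans hswap.symm) hn' hq'
  rw [hswap, hswap'] at k2
  have k0 : hull π {x, q, z} ∩ hull π {q, y, z} ⊆ hull π ({x, q, z} ∩ {q, y, z}) := by
    rw [hull_triple, hull_triple]
    refine (convexHull_split_inter hn hq).trans ?_
    rw [← hull_pair]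
    exact hull_mono π fun l hl => by
      simp only [Finset.mem_insert, Finset.mem_singleton, Finset.mem_inter] at hl ⊢; tauto
  refine ⟨?_, ?_, ?_, ?_⟩
  · intro F hF
    simp only [Finset.mem_insert] at hF
    rcases hF with rfl | rfl | hF
    · exact ⟨_, _, _, rfl⟩
    · exact ⟨_, _, _, rfl⟩
    · exact h.triple F (Finset.mem_of_mem_erase hF)
  · intro F hF
    simp only [Finset.mem_insert] at hF
    rcases hF with rfl | rfl | hF
    · rw [image_triple]; exact not_collinear_of_mem_openSegment hn hq
    · rw [image_triple, Set.insert_comm]; exact not_collinear_of_mem_openSegment hn' hq'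
    · exact h.indep F (Finset.mem_of_mem_erase hF)
  · rw [Finset.set_biUnion_insert, Finset.set_biUnion_insert, ← Set.union_assoc, hull_triple,
      hull_triple, ← convexHull_split hq, ← hull_triple, ← Finset.set_biUnion_insert,
      Finset.insert_erase hF, h.cover]
  · intro F hF G hG hne
    simp only [Finset.mem_insert] at hF hG
    rcases hF with rfl | rfl | hF <;> rcases hG with rfl | rfl | hG
    · exact absurd rfl hne
    · exact k0
    · exact k1 G hG
    · rw [Set.inter_comm, Finset.inter_comm]; exact k0
    · exact absurd rfl hne
    · exact k2 G hG
    · rw [Set.inter_comm, Finset.inter_comm]; exact k1 F hF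
    · rw [Set.inter_comm, Finset.inter_comm]; exact k2 F hF
    · exact h.inter F (Finset.mem_of_mem_erase hF) G (Finset.mem_of_mem_erase hG) hne

/-! ### Triangulations by an interior point and by three points on the sides -/

theorem not_collinear_of_interior {x y z p : Plane} (h : ¬ Collinear ℝ ({x, y, z} : Set Plane))
    {α β γ : ℝ} (hγ : 0 < γ) (hs : α + β + γ = 1) (hp : p = α • x + β • y + γ • z) :
    ¬ Collinear ℝ ({x, y, p} : Set Plane) := by
  rw [not_collinear_iff] at h ⊢
  intro a b c h0 h1
  obtain ⟨h2, h3, h4⟩ := h (a + c * α) (b + c * β) (c * γ) (by linear_combination h0 + c * hs)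
    (by rw [← h1, hp]; module)
  have hc : c = 0 := by simpa [hγ.ne'] using h4
  subst hc
  exact ⟨by linarith, by linarith, rfl⟩

/-- Of the three triangles spanned by a side and an interior point `p`, two meet along the segment
from `p` to their common vertex. -/
theorem convexHull_inter_of_interior {x y z p : Plane}
    (h : ¬ Collinear ℝ ({x, y, z} : Set Plane)) {α β γ : ℝ} (hα : 0 < α) (hγ : 0 < γ)
    (hs : α + β + γ = 1) (hp : p = α • x + β • y + γ • z) :
    convexHull ℝ {x, y, p} ∩ convexHull ℝ ({y, z, p} : Set Plane) ⊆ segment ℝ y p := by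
  rintro q ⟨hq, hq'⟩
  obtain ⟨a, b, c, ha, hb, hc, h1, rfl⟩ := mem_convexHull_triple.1 hq
  obtain ⟨a', b', c', ha', hb', hc', h1', he⟩ := mem_convexHull_triple.1 hq'
  obtain ⟨e1, e2, e3⟩ := eq_of_not_collinear h (a := a + c * α) (b := b + c * β) (c := c * γ)
    (a' := c' * α) (b' := a' + c' * β) (c' := b' + c' * γ) (by linear_combination h1 + c * hs)
    (by linear_combination h1' + c' * hs) (by
      refine Eq.trans ?_ (he.symm.trans ?_) <;> rw [hp] <;> module)
  have hcc : c ≤ c' := le_of_mul_le_mul_right (by linarith) hα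
  have hcc' : c' ≤ c := le_of_mul_le_mul_right (by linarith) hγ
  obtain rfl : c = c' := le_antisymm hcc hcc'
  obtain rfl : a = 0 := by linarith
  exact ⟨b, c, hb, hc, by linarith, by module⟩

/-- A point whose barycentric coordinate at `x`, relative to that of `p`, is the least of the
three lies in the triangle `y z p`. -/
theorem mem_convexHull_of_interior {x y z p : Plane} {α β γ : ℝ} (hα : 0 < α)
    (hs : α + β + γ = 1) (hp : p = α • x + β • y + γ • z) {a b c : ℝ} (ha : 0 ≤ a)
    (h1 : a + b + c = 1) (hb : a * β ≤ b * α) (hc : a * γ ≤ c * α) :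
    a • x + b • y + c • z ∈ convexHull ℝ ({y, z, p} : Set Plane) := by
  refine mem_convexHull_triple.2 ⟨b - a / α * β, c - a / α * γ, a / α, ?_, ?_, by positivity, ?_, ?_⟩
  · rw [sub_nonneg, div_mul_eq_mul_div, div_le_iff₀ hα]; exact hb
  · rw [sub_nonneg, div_mul_eq_mul_div, div_le_iff₀ hα]; exact hc
  · field_simp; linear_combination α * h1 - a * hs
  · rw [hp]; match_scalars <;> field_simp <;> ring

/-- The triangulation of a triangle by joining an interior point to the vertices. -/
theorem tiles_interior {π : Label → Plane} {x y z p : Label}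
    (h : ¬ Collinear ℝ ({π x, π y, π z} : Set Plane)) {α β γ : ℝ} (hα : 0 < α) (hβ : 0 < β)
    (hγ : 0 < γ) (hs : α + β + γ = 1) (hp : π p = α • π x + β • π y + γ • π z) :
    Tiles π {{x, y, p}, {y, z, p}, {z, x, p}} (convexHull ℝ {π x, π y, π z}) := by
  have h' : ¬ Collinear ℝ ({π y, π z, π x} : Set Plane) := by
    rwa [show ({π y, π z, π x} : Set Plane) = {π x, π y, π z} by ext; simp; tauto]
  have h'' : ¬ Collinear ℝ ({π z, π x, π y} : Set Plane) := by
    rwa [show ({π z, π x, π y} : Set Plane) = {π x, π y, π z} by ext; simp; tauto]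
  have hs' : β + γ + α = 1 := by linarith
  have hs'' : γ + α + β = 1 := by linarith
  have hp' : π p = β • π y + γ • π z + α • π x := by rw [hp]; abel
  have hp'' : π p = γ • π z + α • π x + β • π y := by rw [hp]; abel
  have k : ∀ {x y z : Label}, convexHull ℝ {π x, π y, π p} ∩ convexHull ℝ {π y, π z, π p} ⊆
      segment ℝ (π y) (π p) →
      hull π {x, y, p} ∩ hull π {y, z, p} ⊆ hull π ({x, y, p} ∩ {y, z, p}) := by
    intro x y z h
    rw [hull_triple, hull_triple]
    refine h.trans ?_
    rw [← hull_pair]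
    exact hull_mono π fun l hl => by
      simp only [Finset.mem_insert, Finset.mem_singleton, Finset.mem_inter] at hl ⊢; tauto
  have k1 := k (convexHull_inter_of_interior h hα hγ hs hp)
  have k2 := k (convexHull_inter_of_interior h' hβ hα hs' hp')
  have k3 := k (convexHull_inter_of_interior h'' hγ hβ hs'' hp'')
  have hpm : π p ∈ convexHull ℝ {π x, π y, π z} :=
    mem_convexHull_triple.2 ⟨α, β, γ, hα.le, hβ.le, hγ.le, hs, hp.symm⟩
  refine ⟨?_, ?_, ?_, ?_⟩
  · intro F hF
    simp only [Finset.mem_insert, Finset.mem_singleton] at hF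
    rcases hF with rfl | rfl | rfl <;> exact ⟨_, _, _, rfl⟩
  · intro F hF
    simp only [Finset.mem_insert, Finset.mem_singleton] at hF
    rcases hF with rfl | rfl | rfl <;> rw [image_triple]
    exacts [not_collinear_of_interior h hγ hs hp, not_collinear_of_interior h' hα hs' hp',
      not_collinear_of_interior h'' hβ hs'' hp'']
  · rw [Finset.set_biUnion_insert, Finset.set_biUnion_insert, Finset.set_biUnion_singleton,
      hull_triple, hull_triple, hull_triple]
    apply Set.Subset.antisymm
    · refine Set.union_subset ?_ (Set.union_subset ?_ ?_) <;>
        refine convexHull_min ?_ (convex_convexHull ℝ _) <;>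
        (rintro w (rfl | rfl | rfl)) <;> first | exact hpm | exact subset_convexHull _ _ (by simp)
    · intro q hq
      obtain ⟨a, b, c, ha, hb, hc, h1, rfl⟩ := mem_convexHull_triple.1 hq
      -- The face containing the point is opposite the vertex with the least relative weight.
      rcases le_total (a * β) (b * α) with hab | hab
      · rcases le_total (a * γ) (c * α) with hac | hac
        · exact Or.inr (Or.inl (mem_convexHull_of_interior hα hs hp ha h1 hab hac))
        · refine Or.inl ?_
          rw [show a • π x + b • π y + c • π z = c • π z + a • π x + b • π y by abel]
          refine mem_convexHull_of_interior hγ hs'' hp'' hc (by linarith) hac ?_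
          refine le_of_mul_le_mul_right ?_ hα
          nlinarith
      · rcases le_total (b * γ) (c * β) with hbc | hbc
        · refine Or.inr (Or.inr ?_)
          rw [show a • π x + b • π y + c • π z = b • π y + c • π z + a • π x by abel]
          exact mem_convexHull_of_interior hβ hs' hp' hb (by linarith) hbc hab
        · refine Or.inl ?_
          rw [show a • π x + b • π y + c • π z = c • π z + a • π x + b • π y by abel]
          refine mem_convexHull_of_interior hγ hs'' hp'' hc (by linarith) ?_ hbc
          refine le_of_mul_le_mul_right ?_ hβ
          nlinarith
  · intro F hF G hG hne
    simp only [Finset.mem_insert, Finset.mem_singleton] at hF hG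
    rcases hF with rfl | rfl | rfl <;> rcases hG with rfl | rfl | rfl
    · exact absurd rfl hne
    · exact k1
    · rw [Set.inter_comm, Finset.inter_comm]; exact k3
    · rw [Set.inter_comm, Finset.inter_comm]; exact k1
    · exact absurd rfl hne
    · exact k2
    · exact k3
    · rw [Set.inter_comm, Finset.inter_comm]; exact k2
    · exact absurd rfl hne

theorem not_collinear_corner {x y z r t : Plane} (h : ¬ Collinear ℝ ({x, y, z} : Set Plane))
    (hr : r ∈ openSegment ℝ x y) (ht : t ∈ openSegment ℝ z x) :
    ¬ Collinear ℝ ({x, r, t} : Set Plane) := by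
  have h1 := not_collinear_of_mem_openSegment h hr
  rw [show ({x, r, z} : Set Plane) = {x, z, r} by ext; simp; tauto] at h1
  have h2 := not_collinear_of_mem_openSegment h1 (openSegment_symm ℝ z x ▸ ht)
  rwa [show ({x, t, r} : Set Plane) = {x, r, t} by ext; simp; tauto] at h2

theorem not_collinear_medial {x y z r s t : Plane} (h : ¬ Collinear ℝ ({x, y, z} : Set Plane))
    (hr : r ∈ openSegment ℝ x y) (hs : s ∈ openSegment ℝ y z) (ht : t ∈ openSegment ℝ z x) :
    ¬ Collinear ℝ ({r, s, t} : Set Plane) := by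
  obtain ⟨r1, r2, hr1, hr2, hrs, rfl⟩ := hr
  obtain ⟨s1, s2, hs1, hs2, hss, rfl⟩ := hs
  obtain ⟨t1, t2, ht1, ht2, hts, rfl⟩ := ht
  rw [not_collinear_iff] at h ⊢
  intro a b c h0 h1
  obtain ⟨h2, h3, h4⟩ := h (a * r1 + c * t2) (a * r2 + b * s1) (b * s2 + c * t1)
    (by linear_combination h0 + a * hrs + b * hss + c * hts)
    (by rw [← h1]; module)
  have hc : c * (t2 * r2 * s2 + r1 * s1 * t1) = 0 := by
    linear_combination r2 * s2 * h2 - r1 * s2 * h3 + r1 * s1 * h4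
  have hc : c = 0 := by
    have : t2 * r2 * s2 + r1 * s1 * t1 ≠ 0 := by positivity
    simpa [this] using hc
  subst hc
  have ha : a = 0 := by simpa [hr1.ne'] using h2
  subst ha
  exact ⟨rfl, by linarith, rfl⟩

theorem corner_inter_medial {x y z r s t : Plane} (h : ¬ Collinear ℝ ({x, y, z} : Set Plane))
    (hr : r ∈ openSegment ℝ x y) (hs : s ∈ openSegment ℝ y z) (ht : t ∈ openSegment ℝ z x) :
    convexHull ℝ {x, r, t} ∩ convexHull ℝ ({r, s, t} : Set Plane) ⊆ segment ℝ r t := by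
  obtain ⟨r1, r2, hr1, hr2, hrs, rfl⟩ := hr
  obtain ⟨s1, s2, hs1, hs2, hss, rfl⟩ := hs
  obtain ⟨t1, t2, ht1, ht2, hts, rfl⟩ := ht
  rintro q ⟨hq, hq'⟩
  obtain ⟨a, b, c, ha, hb, hc, h1, rfl⟩ := mem_convexHull_triple.1 hq
  obtain ⟨a', b', c', ha', hb', hc', h1', he⟩ := mem_convexHull_triple.1 hq'
  obtain ⟨e1, e2, e3⟩ := eq_of_not_collinear h (a := a + b * r1 + c * t2) (b := b * r2)
    (c := c * t1) (a' := a' * r1 + c' * t2) (b' := a' * r2 + b' * s1) (c' := b' * s2 + c' * t1)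
    (by linear_combination h1 + b * hrs + c * hts)
    (by linear_combination h1' + a' * hrs + b' * hss + c' * hts) (by
      refine Eq.trans ?_ (he.symm.trans ?_) <;> module)
  have p1 := mul_nonneg hb' hs1.le
  have p2 := mul_nonneg hb' hs2.le
  have hba : a' ≤ b := le_of_mul_le_mul_right (by linarith) hr2
  have hcc : c' ≤ c := le_of_mul_le_mul_right (by linarith) ht1
  have p3 := mul_le_mul_of_nonneg_right hba hr1.le
  have p4 := mul_le_mul_of_nonneg_right hcc ht2.le
  obtain rfl : a = 0 := by linarith
  exact ⟨b, c, hb, hc, by linarith, by module⟩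

theorem corner_inter_corner {x y z r s t : Plane} (h : ¬ Collinear ℝ ({x, y, z} : Set Plane))
    (hr : r ∈ openSegment ℝ x y) (hs : s ∈ openSegment ℝ y z) (ht : t ∈ openSegment ℝ z x) :
    convexHull ℝ {x, r, t} ∩ convexHull ℝ ({y, s, r} : Set Plane) ⊆ {r} := by
  obtain ⟨r1, r2, hr1, hr2, hrs, rfl⟩ := hr
  obtain ⟨s1, s2, hs1, hs2, hss, rfl⟩ := hs
  obtain ⟨t1, t2, ht1, ht2, hts, rfl⟩ := ht
  rintro q ⟨hq, hq'⟩
  obtain ⟨a, b, c, ha, hb, hc, h1, rfl⟩ := mem_convexHull_triple.1 hq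
  obtain ⟨a', b', c', ha', hb', hc', h1', he⟩ := mem_convexHull_triple.1 hq'
  obtain ⟨e1, e2, e3⟩ := eq_of_not_collinear h (a := a + b * r1 + c * t2) (b := b * r2)
    (c := c * t1) (a' := c' * r1) (b' := a' + b' * s1 + c' * r2) (c' := b' * s2)
    (by linear_combination h1 + b * hrs + c * hts)
    (by linear_combination h1' + b' * hss + c' * hrs) (by
      refine Eq.trans ?_ (he.symm.trans ?_) <;> module)
  have p1 := mul_nonneg hb' hs1.le
  have p2 := mul_nonneg hc ht2.le
  have hcb : c' ≤ b := le_of_mul_le_mul_right (by linarith) hr2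
  have hbc : b ≤ c' := le_of_mul_le_mul_right (by linarith) hr1
  obtain rfl : b = c' := le_antisymm hbc hcb
  obtain rfl : a = 0 := by linarith
  have hc0 : c = 0 := by
    have : c * t2 = 0 := by linarith
    simpa [ht2.ne'] using this
  subst hc0
  obtain rfl : b = 1 := by linarith
  simp

theorem convexHull_medial_subset {x y z r s t : Plane} (hr : r ∈ openSegment ℝ x y)
    (hs : s ∈ openSegment ℝ y z) (ht : t ∈ openSegment ℝ z x) :
    convexHull ℝ ({x, y, z} : Set Plane) ⊆ convexHull ℝ {x, r, t} ∪ convexHull ℝ {y, s, r} ∪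
      convexHull ℝ {z, t, s} ∪ convexHull ℝ {r, s, t} := by
  -- The diagonals of the quadrilateral `r s z t` cross at `m`.
  obtain ⟨m, hm, hm'⟩ : ∃ m, m ∈ openSegment ℝ r z ∧ m ∈ openSegment ℝ t s := by
    obtain ⟨r1, r2, hr1, hr2, hrs, rfl⟩ := hr
    obtain ⟨s1, s2, hs1, hs2, hss, rfl⟩ := hs
    obtain ⟨t1, t2, ht1, ht2, hts, rfl⟩ := ht
    have hD : 0 < r1 * s1 + r2 * t2 := by positivity
    obtain rfl : r2 = 1 - r1 := by linarith
    obtain rfl : s2 = 1 - s1 := by linarith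
    obtain rfl : t1 = 1 - t2 := by linarith
    refine ⟨_, ⟨s1 * t2 / (r1 * s1 + (1 - r1) * t2),
      (r1 * s1 * (1 - t2) + (1 - r1) * t2 * (1 - s1)) / (r1 * s1 + (1 - r1) * t2), by positivity,
      by positivity, by field_simp; ring, rfl⟩,
      ⟨r1 * s1 / (r1 * s1 + (1 - r1) * t2), (1 - r1) * t2 / (r1 * s1 + (1 - r1) * t2), by positivity,
      by positivity, by field_simp, ?_⟩⟩
    match_scalars <;> field_simp
  have hms : m ∈ segment ℝ t s := openSegment_subset_segment _ _ _ hm'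
  have hsub : ∀ a b c : Plane, ∀ S : Set Plane, Convex ℝ S → a ∈ S → b ∈ S → c ∈ S →
      convexHull ℝ {a, b, c} ⊆ S := fun a b c S hS ha hb hc =>
    convexHull_min (by rintro w (rfl | rfl | rfl) <;> assumption) hS
  have hC : ∀ a b c : Plane, Convex ℝ (convexHull ℝ {a, b, c}) := fun a b c => convex_convexHull ℝ _
  have hin : ∀ a b c w : Plane, w ∈ ({a, b, c} : Set Plane) → w ∈ convexHull ℝ {a, b, c} :=
    fun a b c w hw => subset_convexHull _ _ hw
  have m1 : m ∈ convexHull ℝ {r, s, t} := segment_subset_convexHull (by simp) (by simp) hms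
  have m2 : m ∈ convexHull ℝ {z, t, s} := segment_subset_convexHull (by simp) (by simp) hms
  intro p hp
  rw [convexHull_split hr] at hp
  rcases hp with hp | hp
  · rw [show ({x, r, z} : Set Plane) = {z, x, r} by ext; simp; tauto, convexHull_split ht] at hp
    rcases hp with hp | hp
    · rw [show ({z, t, r} : Set Plane) = {r, z, t} by ext; simp; tauto, convexHull_split hm] at hp
      rcases hp with hp | hp
      · exact Or.inr (hsub _ _ _ _ (hC _ _ _) (hin _ _ _ _ (by simp)) m1 (hin _ _ _ _ (by simp)) hp)
      · exact Or.inl (Or.inr (hsub _ _ _ _ (hC _ _ _) m2 (hin _ _ _ _ (by simp))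
          (hin _ _ _ _ (by simp)) hp))
    · exact Or.inl (Or.inl (Or.inl (hsub _ _ _ _ (hC _ _ _) (hin _ _ _ _ (by simp))
        (hin _ _ _ _ (by simp)) (hin _ _ _ _ (by simp)) hp)))
  · rw [show ({r, y, z} : Set Plane) = {y, z, r} by ext; simp; tauto, convexHull_split hs] at hp
    rcases hp with hp | hp
    · exact Or.inl (Or.inl (Or.inr (hsub _ _ _ _ (hC _ _ _) (hin _ _ _ _ (by simp))
        (hin _ _ _ _ (by simp)) (hin _ _ _ _ (by simp)) hp)))
    · rw [show ({s, z, r} : Set Plane) = {r, z, s} by ext; simp; tauto, convexHull_split hm] at hp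
      rcases hp with hp | hp
      · exact Or.inr (hsub _ _ _ _ (hC _ _ _) (hin _ _ _ _ (by simp)) m1 (hin _ _ _ _ (by simp)) hp)
      · exact Or.inl (Or.inr (hsub _ _ _ _ (hC _ _ _) m2 (hin _ _ _ _ (by simp))
          (hin _ _ _ _ (by simp)) hp))

/-- The triangulation of a triangle into three corners and a central triangle with one vertex on
each side. -/
theorem tiles_medial {π : Label → Plane} {x y z r s t : Label}
    (h : ¬ Collinear ℝ ({π x, π y, π z} : Set Plane)) (hr : π r ∈ openSegment ℝ (π x) (π y))
    (hs : π s ∈ openSegment ℝ (π y) (π z)) (ht : π t ∈ openSegment ℝ (π z) (π x)) :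
    Tiles π {{x, r, t}, {y, s, r}, {z, t, s}, {r, s, t}} (convexHull ℝ {π x, π y, π z}) := by
  have h' : ¬ Collinear ℝ ({π y, π z, π x} : Set Plane) := by
    rwa [show ({π y, π z, π x} : Set Plane) = {π x, π y, π z} by ext; simp; tauto]
  have h'' : ¬ Collinear ℝ ({π z, π x, π y} : Set Plane) := by
    rwa [show ({π z, π x, π y} : Set Plane) = {π x, π y, π z} by ext; simp; tauto]
  have c : ∀ {F G : Finset Label}, hull π F ∩ hull π G ⊆ hull π (F ∩ G) →
      hull π G ∩ hull π F ⊆ hull π (G ∩ F) := fun h => by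
    rwa [Set.inter_comm, Finset.inter_comm]
  have e1 : ({s, t, r} : Finset Label) = {r, s, t} := by ext; simp; tauto
  have e2 : ({t, r, s} : Finset Label) = {r, s, t} := by ext; simp; tauto
  have k : ∀ {x r s t : Label}, convexHull ℝ {π x, π r, π t} ∩ convexHull ℝ {π r, π s, π t} ⊆
      segment ℝ (π r) (π t) →
      hull π {x, r, t} ∩ hull π {r, s, t} ⊆ hull π ({x, r, t} ∩ {r, s, t}) := by
    intro x r s t h
    rw [hull_triple, hull_triple]
    refine h.trans ?_
    rw [← hull_pair]
    exact hull_mono π fun l hl => by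
      simp only [Finset.mem_insert, Finset.mem_singleton, Finset.mem_inter] at hl ⊢; tauto
  have k1 := k (corner_inter_medial h hr hs ht)
  have k2 := k (corner_inter_medial h' hs ht hr)
  have k3 := k (corner_inter_medial h'' ht hr hs)
  rw [e1] at k2
  rw [e2] at k3
  have k' : ∀ {x y r s t : Label}, convexHull ℝ {π x, π r, π t} ∩ convexHull ℝ {π y, π s, π r} ⊆
      {π r} → hull π {x, r, t} ∩ hull π {y, s, r} ⊆ hull π ({x, r, t} ∩ {y, s, r}) := by
    intro x y r s t h
    rw [hull_triple, hull_triple]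
    refine h.trans ?_
    rw [← hull_singleton]
    exact hull_mono π fun l hl => by
      simp only [Finset.mem_insert, Finset.mem_singleton, Finset.mem_inter] at hl ⊢; tauto
  have k4 := k' (corner_inter_corner h hr hs ht)
  have k5 := k' (corner_inter_corner h' hs ht hr)
  have k6 := k' (corner_inter_corner h'' ht hr hs)
  refine ⟨?_, ?_, ?_, ?_⟩
  · intro F hF
    simp only [Finset.mem_insert, Finset.mem_singleton] at hF
    rcases hF with rfl | rfl | rfl | rfl <;> exact ⟨_, _, _, rfl⟩
  · intro F hF
    simp only [Finset.mem_insert, Finset.mem_singleton] at hF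
    rcases hF with rfl | rfl | rfl | rfl <;> rw [image_triple]
    exacts [not_collinear_corner h hr ht, not_collinear_corner h' hs hr,
      not_collinear_corner h'' ht hs, not_collinear_medial h hr hs ht]
  · simp only [Finset.set_biUnion_insert, Finset.set_biUnion_singleton, hull_triple]
    apply Set.Subset.antisymm
    · have g : ∀ w ∈ ({π x, π y, π z} : Set Plane), w ∈ convexHull ℝ {π x, π y, π z} :=
        fun w hw => subset_convexHull _ _ hw
      have gr : π r ∈ convexHull ℝ {π x, π y, π z} :=
        segment_subset_convexHull (by simp) (by simp) (openSegment_subset_segment _ _ _ hr)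
      have gs : π s ∈ convexHull ℝ {π x, π y, π z} :=
        segment_subset_convexHull (by simp) (by simp) (openSegment_subset_segment _ _ _ hs)
      have gt : π t ∈ convexHull ℝ {π x, π y, π z} :=
        segment_subset_convexHull (by simp) (by simp) (openSegment_subset_segment _ _ _ ht)
      refine Set.union_subset ?_ (Set.union_subset ?_ (Set.union_subset ?_ ?_)) <;>
        refine convexHull_min ?_ (convex_convexHull ℝ _) <;>
        (rintro w (rfl | rfl | rfl)) <;>
        first | exact gr | exact gs | exact gt | exact g _ (by simp)
    · refine (convexHull_medial_subset hr hs ht).trans ?_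
      simp only [Set.union_assoc]
      exact subset_rfl
  · intro F hF G hG hne
    simp only [Finset.mem_insert, Finset.mem_singleton] at hF hG
    rcases hF with rfl | rfl | rfl | rfl <;> rcases hG with rfl | rfl | rfl | rfl <;>
      first
      | exact absurd rfl hne
      | assumption
      | exact c ‹_›

theorem tiles_triangle {π : Label → Plane} {x y z : Label}
    (h : ¬ Collinear ℝ ({π x, π y, π z} : Set Plane)) :
    Tiles π {{x, y, z}} (convexHull ℝ {π x, π y, π z}) := by
  refine ⟨?_, ?_, ?_, ?_⟩
  · intro F hF
    exact ⟨x, y, z, Finset.mem_singleton.1 hF⟩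
  · intro F hF
    rwa [Finset.mem_singleton.1 hF, image_triple]
  · rw [Finset.set_biUnion_singleton, hull_triple]
  · intro F hF G hG hne
    exact absurd ((Finset.mem_singleton.1 hF).trans (Finset.mem_singleton.1 hG).symm) hne

/-! ### Barycentric coordinates of a base triangle -/

namespace BaseTriangle

variable (T : BaseTriangle)

theorem affineIndependent : AffineIndependent ℝ T.vertex := by
  have h : T.vertex = ![T.vertex 0, T.vertex 1, T.vertex 2] := by
    ext i : 1; fin_cases i <;> rfl
  rw [h, affineIndependent_iff_not_collinear_set]
  intro hc
  have e01 := T.equilateral 0 1 (by decide)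
  have e12 := T.equilateral 1 2 (by decide)
  have e02 := T.equilateral 0 2 (by decide)
  have hp := T.edgeLength_pos
  rcases hc.wbtw_or_wbtw_or_wbtw with h | h | h
  · have := h.dist_add_dist; linarith
  · have := h.dist_add_dist
    rw [dist_comm _ (T.vertex 0), dist_comm _ (T.vertex 0)] at this
    linarith
  · have := h.dist_add_dist
    rw [dist_comm _ (T.vertex 0), dist_comm (T.vertex 2)] at this
    linarith

/-- The vertices of a base triangle as an affine basis of the plane. -/
noncomputable def basis : AffineBasis (Fin 3) ℝ Plane :=
  ⟨T.vertex, T.affineIndependent, by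
    apply T.affineIndependent.affineSpan_eq_top_iff_card_eq_finrank_add_one.2
    simp⟩

/-- The barycentric coordinate belonging to the vertex `i`. -/
noncomputable def coord (i : Fin 3) : Plane →ᵃ[ℝ] ℝ := T.basis.coord i

theorem coord_vertex_self (i : Fin 3) : T.coord i (T.vertex i) = 1 :=
  T.basis.coord_apply_eq i

theorem coord_vertex_ne {i j : Fin 3} (h : i ≠ j) : T.coord i (T.vertex j) = 0 :=
  T.basis.coord_apply_ne h

theorem mem_carrier {p : Plane} : p ∈ T.carrier ↔ ∀ i, 0 ≤ T.coord i p := by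
  have := T.basis.convexHull_eq_nonneg_coord
  rw [show Set.range T.basis = Set.range T.vertex from rfl] at this
  rw [carrier, this]; rfl

theorem convex_carrier : Convex ℝ T.carrier := convex_convexHull ℝ _

theorem isClosed_carrier : IsClosed T.carrier :=
  ((Set.finite_range T.vertex).isCompact_convexHull ℝ).isClosed

theorem coord_combo (l : Fin 3) (a b : ℝ) (h : a + b = 1) (x y : Plane) :
    T.coord l (a • x + b • y) = a * T.coord l x + b * T.coord l y := by
  rw [Convex.combo_affine_apply h]; simp

end BaseTriangle

/-- Three distinct indices: a way of calling the vertices `i, j, k` of a triangle `A, B, C`. -/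
structure Frame (i j k : Fin 3) : Prop where
  ij : i ≠ j
  jk : j ≠ k
  ik : i ≠ k

namespace Frame

variable {i j k : Fin 3}

theorem rotate (h : Frame i j k) : Frame j k i := ⟨h.jk, h.ik.symm, h.ij.symm⟩

theorem reverse (h : Frame i j k) : Frame k j i := ⟨h.jk.symm, h.ij.symm, h.ik.symm⟩

theorem swap_right (h : Frame i j k) : Frame i k j := ⟨h.ik, h.jk.symm, h.ij⟩

theorem swap (h : Frame i j k) : Frame j i k := ⟨h.ij.symm, h.ik, h.jk⟩

theorem eq_or (h : Frame i j k) (l : Fin 3) : l = i ∨ l = j ∨ l = k := by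
  obtain ⟨h1, h2, h3⟩ := h; omega

theorem univ_eq (h : Frame i j k) : (Finset.univ : Finset (Fin 3)) = {i, j, k} := by
  ext l; simpa using h.eq_or l

theorem exists_perm (h : Frame i j k) : ∃ s : Equiv.Perm (Fin 3), s 0 = i ∧ s 1 = j ∧ s 2 = k := by
  refine ⟨Equiv.ofBijective ![i, j, k] ((Fintype.bijective_iff_injective_and_card _).2 ⟨?_, rfl⟩),
    rfl, rfl, rfl⟩
  obtain ⟨h1, h2, h3⟩ := h
  intro a b hab
  fin_cases a <;> fin_cases b <;> simp_all

theorem exists_third {i j : Fin 3} (h : i ≠ j) : ∃ k, Frame i j k := by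
  revert h; revert i j
  have : ∀ i j : Fin 3, i ≠ j → ∃ k, i ≠ j ∧ j ≠ k ∧ i ≠ k := by decide
  intro i j h
  obtain ⟨k, h1, h2, h3⟩ := this i j h
  exact ⟨k, h1, h2, h3⟩

theorem exists_of_index (i : Fin 3) : ∃ j k, Frame i j k := by
  have : ∀ i : Fin 3, ∃ j k, i ≠ j ∧ j ≠ k ∧ i ≠ k := by decide
  obtain ⟨j, k, h1, h2, h3⟩ := this i
  exact ⟨j, k, h1, h2, h3⟩

variable (h : Frame i j k) (T : BaseTriangle)
include h

theorem sum_coord (p : Plane) : T.coord i p + T.coord j p + T.coord k p = 1 := by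
  have := T.basis.sum_coord_apply_eq_one p
  rw [h.univ_eq, Finset.sum_insert (by simp [h.ij, h.ik]), Finset.sum_pair h.jk] at this
  rw [← this]; simp only [BaseTriangle.coord]; ring

theorem combo_eq (p : Plane) :
    T.coord i p • T.vertex i + T.coord j p • T.vertex j + T.coord k p • T.vertex k = p := by
  have := T.basis.linear_combination_coord_eq_self p
  rw [h.univ_eq, Finset.sum_insert (by simp [h.ij, h.ik]), Finset.sum_pair h.jk] at this
  rw [← add_assoc] at this
  exact this

theorem ext {p q : Plane} (hi : T.coord i p = T.coord i q) (hj : T.coord j p = T.coord j q) :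
    p = q := by
  have hk : T.coord k p = T.coord k q := by
    have := h.sum_coord T p; have := h.sum_coord T q; linarith
  rw [← h.combo_eq T p, ← h.combo_eq T q, hi, hj, hk]

theorem eq_vertex {p : Plane} (hj : T.coord j p = 0) (hk : T.coord k p = 0) : p = T.vertex i := by
  apply h.rotate.ext T
  · rw [hj, T.coord_vertex_ne h.ij.symm]
  · rw [hk, T.coord_vertex_ne h.ik.symm]

theorem mem_carrier {p : Plane} :
    p ∈ T.carrier ↔ 0 ≤ T.coord i p ∧ 0 ≤ T.coord j p ∧ 0 ≤ T.coord k p := by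
  rw [T.mem_carrier]
  refine ⟨fun H => ⟨H i, H j, H k⟩, fun H l => ?_⟩
  rcases h.eq_or l with rfl | rfl | rfl
  exacts [H.1, H.2.1, H.2.2]

theorem not_collinear : ¬ Collinear ℝ {T.vertex i, T.vertex j, T.vertex k} := by
  have := T.affineIndependent
  rw [← affineIndependent_iff_not_collinear_set]
  have hinj : Function.Injective ![i, j, k] := by
    obtain ⟨h1, h2, h3⟩ := h
    intro a b hab
    fin_cases a <;> fin_cases b <;> simp_all
  have e : T.vertex ∘ ![i, j, k] = ![T.vertex i, T.vertex j, T.vertex k] := by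
    funext l
    fin_cases l <;> rfl
  exact e ▸ this.comp_embedding ⟨![i, j, k], hinj⟩

theorem range_vertex : Set.range T.vertex = {T.vertex i, T.vertex j, T.vertex k} := by
  ext p
  constructor
  · rintro ⟨l, rfl⟩
    rcases h.eq_or l with rfl | rfl | rfl <;> simp
  · rintro (rfl | rfl | rfl) <;> exact ⟨_, rfl⟩

theorem carrier_eq : T.carrier = convexHull ℝ {T.vertex i, T.vertex j, T.vertex k} := by
  rw [BaseTriangle.carrier, h.range_vertex]

/-- Points of a line parallel to the side opposite to `j` are ordered by the coordinate `k`. -/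
theorem mem_openSegment {x y z : Plane} (hxy : T.coord j x = T.coord j y)
    (hyz : T.coord j y = T.coord j z) (h1 : T.coord k x < T.coord k y)
    (h2 : T.coord k y < T.coord k z) : y ∈ openSegment ℝ x z := by
  have hd : 0 < T.coord k z - T.coord k x := by linarith
  refine ⟨(T.coord k z - T.coord k y) / (T.coord k z - T.coord k x),
    (T.coord k y - T.coord k x) / (T.coord k z - T.coord k x), div_pos (by linarith) hd,
    div_pos (by linarith) hd, by field_simp; ring, ?_⟩
  have hs : (T.coord k z - T.coord k y) / (T.coord k z - T.coord k x) +
    (T.coord k y - T.coord k x) / (T.coord k z - T.coord k x) = 1 := by field_simp; ring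
  apply h.rotate.ext T
  · rw [T.coord_combo j _ _ hs, ← hyz, hxy, ← add_mul, hs, one_mul]
  · rw [T.coord_combo k _ _ hs]; field_simp; ring

end Frame

/-- The edge `l` is opposite to the vertex `l + 2`. -/
theorem BaseTriangle.mem_edge (T : BaseTriangle) {l : Fin 3} {p : Plane} :
    p ∈ T.edge l ↔ p ∈ T.carrier ∧ T.coord (l + 2) p = 0 := by
  have h : Frame l (l + 1) (l + 2) := by
    constructor <;> revert l <;> decide
  constructor
  · rintro ⟨a, b, ha, hb, hab, rfl⟩
    refine ⟨T.convex_carrier (subset_convexHull _ _ ⟨_, rfl⟩) (subset_convexHull _ _ ⟨_, rfl⟩)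
      ha hb hab, ?_⟩
    rw [T.coord_combo _ _ _ hab, T.coord_vertex_ne h.ik.symm, T.coord_vertex_ne h.jk.symm]
    simp
  · rintro ⟨hp, h0⟩
    have := h.sum_coord T p
    have hp := (h.mem_carrier T).1 hp
    refine ⟨T.coord l p, T.coord (l + 1) p, hp.1, hp.2.1, by linarith, ?_⟩
    conv_rhs => rw [← h.combo_eq T p, h0]
    simp

/-! ### Traces of segments -/

section Trace

theorem add_one_add_two : ∀ m : Fin 3, m + 1 + 2 = m := by decide

theorem add_two_add_one : ∀ m : Fin 3, m + 2 + 1 = m := by decide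

variable {T : BaseTriangle} {S : BoundarySegment} {x y : Plane}

/-- An edge carries an event as soon as the segment meets it, since a single common point is a
vertex or not. -/
theorem edgeEvent_iff (T : BaseTriangle) (S : BoundarySegment) (l : Fin 3) :
    EdgeEvent T S l ↔ (S.carrier ∩ T.edge l).Nonempty := by
  constructor
  · rintro (⟨x, -, -, hx⟩ | (h | h) | h)
    · exact ⟨x, hx ▸ rfl⟩
    · exact ⟨_, h, left_mem_segment ℝ _ _⟩
    · exact ⟨_, h, right_mem_segment ℝ _ _⟩
    · exact h.nonempty
  · intro hne
    by_cases hnt : (S.carrier ∩ T.edge l).Nontrivial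
    · exact Or.inr (Or.inr hnt)
    obtain ⟨x, hx⟩ := (Set.not_nontrivial_iff.1 hnt).eq_empty_or_singleton.resolve_left
      hne.ne_empty
    have hxm : x ∈ S.carrier ∩ T.edge l := hx ▸ rfl
    by_cases h1 : x = T.vertex l
    · exact Or.inr (Or.inl (Or.inl (h1 ▸ hxm.1)))
    by_cases h2 : x = T.vertex (l + 1)
    · exact Or.inr (Or.inl (Or.inr (h2 ▸ hxm.1)))
    exact Or.inl ⟨x, h1, h2, hx⟩

variable (hS : S.carrier ∩ T.carrier = segment ℝ x y)
include hS

theorem trace_left_mem : x ∈ S.carrier ∩ T.carrier := hS ▸ left_mem_segment ℝ x y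

theorem trace_right_mem : y ∈ S.carrier ∩ T.carrier := hS ▸ right_mem_segment ℝ x y

theorem trace_inter_edge (l : Fin 3) :
    S.carrier ∩ T.edge l = {p ∈ segment ℝ x y | T.coord (l + 2) p = 0} := by
  ext p
  rw [Set.mem_inter_iff, T.mem_edge, ← and_assoc, ← Set.mem_inter_iff, hS]; rfl

theorem trace_coord_nonneg (l : Fin 3) : 0 ≤ T.coord l x ∧ 0 ≤ T.coord l y :=
  ⟨T.mem_carrier.1 (trace_left_mem hS).2 l, T.mem_carrier.1 (trace_right_mem hS).2 l⟩

theorem edgeEvent_iff_trace (l : Fin 3) :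
    EdgeEvent T S l ↔ T.coord (l + 2) x = 0 ∨ T.coord (l + 2) y = 0 := by
  rw [edgeEvent_iff, trace_inter_edge hS]
  constructor
  · rintro ⟨p, ⟨a, b, ha, hb, hab, rfl⟩, h0⟩
    rw [T.coord_combo _ _ _ hab] at h0
    obtain ⟨hx, hy⟩ := trace_coord_nonneg hS (l + 2)
    by_contra! hne
    have h1 : 0 < T.coord (l + 2) x := lt_of_le_of_ne hx hne.1.symm
    have h2 : 0 < T.coord (l + 2) y := lt_of_le_of_ne hy hne.2.symm
    have p1 := mul_nonneg ha hx
    have p2 := mul_nonneg hb hy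
    have e1 : a = 0 := by
      have : a * T.coord (l + 2) x = 0 := by linarith
      simpa [h1.ne'] using this
    have e2 : b = 0 := by
      have : b * T.coord (l + 2) y = 0 := by linarith
      simpa [h2.ne'] using this
    linarith
  · rintro (h | h)
    · exact ⟨x, left_mem_segment ℝ x y, h⟩
    · exact ⟨y, right_mem_segment ℝ x y, h⟩

open Classical in
/-- The count of a segment is the number of sides which contain an end of its trace. -/
theorem count_trace {i j k : Fin 3} (h : Frame i j k) :
    intersectionCount T S = (if T.coord i x = 0 ∨ T.coord i y = 0 then 1 else 0) +
      (if T.coord j x = 0 ∨ T.coord j y = 0 then 1 else 0) +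
      (if T.coord k x = 0 ∨ T.coord k y = 0 then 1 else 0) := by
  have e : {l : Fin 3 | EdgeEvent T S l} = (fun m : Fin 3 => m + 1) ''
      {m : Fin 3 | T.coord m x = 0 ∨ T.coord m y = 0} := by
    ext l
    simp only [Set.mem_ofPred_eq, edgeEvent_iff_trace hS, Set.mem_image]
    constructor
    · intro H
      exact ⟨l + 2, H, add_two_add_one l⟩
    · rintro ⟨m, H, rfl⟩
      rwa [add_one_add_two m]
  rw [intersectionCount, e, Set.ncard_image_of_injective _ (add_left_injective 1)]
  have : {m : Fin 3 | T.coord m x = 0 ∨ T.coord m y = 0} =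
      ((Finset.univ.filter fun m => T.coord m x = 0 ∨ T.coord m y = 0 : Finset (Fin 3)) :
        Set (Fin 3)) := by ext; simp
  rw [this, Set.ncard_coe_finset, Finset.card_filter, h.univ_eq,
    Finset.sum_insert (by simp [h.ij, h.ik]), Finset.sum_pair h.jk]
  ring

/-- An isolated intersection point with an edge is an end of the trace. -/
theorem crossing_subset {l : Fin 3} {p : Plane} (hp : S.carrier ∩ T.edge l = {p}) :
    p = x ∨ p = y := by
  have hm : p ∈ S.carrier ∩ T.edge l := hp ▸ rfl
  have he := (edgeEvent_iff_trace hS l).1 ((edgeEvent_iff T S l).2 ⟨p, hm⟩)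
  rw [trace_inter_edge hS] at hp
  rcases he with h | h
  · have hx : x ∈ ({p} : Set Plane) := by rw [← hp]; exact ⟨left_mem_segment ℝ x y, h⟩
    exact Or.inl hx.symm
  · have hy : y ∈ ({p} : Set Plane) := by rw [← hp]; exact ⟨right_mem_segment ℝ x y, h⟩
    exact Or.inr hy.symm

theorem left_crossing {m : Fin 3} (h0 : T.coord m x = 0) (h1 : 0 < T.coord m y ∨ x = y) :
    ∃ l, S.carrier ∩ T.edge l = {x} := by
  refine ⟨m + 1, ?_⟩
  rw [trace_inter_edge hS, add_one_add_two m]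
  ext p
  constructor
  · rintro ⟨⟨a, b, ha, hb, hab, rfl⟩, hp⟩
    rcases h1 with h1 | rfl
    · rw [T.coord_combo _ _ _ hab, h0, mul_zero, zero_add] at hp
      obtain rfl : b = 0 := by simpa [h1.ne'] using hp
      obtain rfl : a = 1 := by linarith
      simp
    · rw [← add_smul, hab]; simp
  · rintro rfl
    exact ⟨left_mem_segment ℝ p y, h0⟩

theorem right_crossing {m : Fin 3} (h0 : T.coord m y = 0) (h1 : 0 < T.coord m x ∨ x = y) :
    ∃ l, S.carrier ∩ T.edge l = {y} :=
  left_crossing (hS.trans (segment_symm ℝ x y)) h0 (h1.imp_right Eq.symm)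

/-- An endpoint of a segment which lies in the triangle is an end of the trace. -/
theorem endpoint_trace {p : Plane} (hp : p ∈ T.carrier) (he : p = S.source ∨ p = S.target) :
    p = x ∨ p = y := by
  wlog hs : p = S.source generalizing S
  · refine this (S := ⟨S.target, S.source⟩) ?_ (Or.symm he) (he.resolve_left hs)
    rw [← hS]; simp only [BoundarySegment.carrier]; rw [segment_symm]
  obtain ⟨u, v⟩ := S
  subst hs
  have hpm : p ∈ segment ℝ x y := hS ▸ ⟨left_mem_segment ℝ p v, hp⟩
  obtain ⟨a, b, ha, hb, hab, hx⟩ := (trace_left_mem hS).1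
  obtain ⟨c, d, hc, hd, hcd, hy⟩ := (trace_right_mem hS).1
  obtain ⟨r, t, hr, ht, hrt, e⟩ := hpm
  simp only at hx hy
  have h0 : (r * b + t * d) • (p - v) = 0 := by
    obtain rfl : b = 1 - a := by linarith
    obtain rfl : d = 1 - c := by linarith
    obtain rfl : t = 1 - r := by linarith
    rw [← sub_eq_zero.2 e.symm, ← hx, ← hy]; module
  rcases smul_eq_zero.1 h0 with h | h
  · have h1 := mul_nonneg hr hb
    have h2 := mul_nonneg ht hd
    rcases mul_eq_zero.1 (show r * b = 0 by linarith) with rfl | rfl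
    · refine Or.inr ?_
      rw [← e, show t = 1 by linarith]; simp
    · refine Or.inl ?_
      rw [← hx, show a = 1 by linarith]; simp
  · refine Or.inl ?_
    rw [← hx, ← sub_eq_zero.1 h, ← add_smul, hab, one_smul]

end Trace

/-! ### From labelled triangulations to templates -/

open Label

/-- The labels of a face as a finite set. -/
def faceFinset (f : Label × Label × Label) : Finset Label := {f.1, f.2.1, f.2.2}

theorem coe_faceFinset (f : Label × Label × Label) :
    (faceFinset f : Set Label) = faceLabels f := by
  simp [faceFinset, faceLabels]

theorem mem_faceLabels {f : Label × Label × Label} {l : Label} :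
    l ∈ faceLabels f ↔ l ∈ faceFinset f := by
  rw [← coe_faceFinset, Finset.mem_coe]

/-- The labels used by a list of faces. -/
def usedLabels (L : List (Label × Label × Label)) : Finset Label := L.toFinset.biUnion faceFinset

theorem Template.mem_labels {τ : Template} {l : Label} :
    l ∈ τ.labels ↔ l ∈ usedLabels τ.faces := by
  simp [Template.labels, usedLabels, mem_faceLabels]

/-- A configuration is covered by the lookup table: its type is canonical, and a template of this
type retriangulates the triangle. -/
def Covered (T : BaseTriangle) (c : List BoundarySegment) : Prop :=
  configurationType T c ∈ canonicalTypes ∧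
    ∃ τ ∈ lookupTable, τ.type = configurationType T c ∧ τ.Retriangulates T c

/-- Placement of the labels: `A, B, C` at the vertices `i, j, k`, the others at given points. The
points given for labels which a template does not use are irrelevant. -/
def BaseTriangle.place (T : BaseTriangle) (i j k : Fin 3) (p q₁ q₂ q₃ q₄ : Plane) : Label → Plane
  | A => T.vertex i
  | B => T.vertex j
  | C => T.vertex k
  | P => p
  | Q1 => q₁
  | Q2 => q₂
  | Q3 => q₃
  | Q4 => q₄

/-- The trace of `S` on the triangle is the edge (or vertex) of a face of `L`. -/
def IsFaceEdge (T : BaseTriangle) (L : List (Label × Label × Label)) (π : Label → Plane)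
    (S : BoundarySegment) : Prop :=
  ∃ u v, (∃ f ∈ L, u ∈ faceFinset f ∧ v ∈ faceFinset f) ∧
    S.carrier ∩ T.carrier = segment ℝ (π u) (π v)

/-- Once the trace of every segment is an edge of a labelled triangulation, the intersection points
and the endpoints in the triangle are automatically among the labelled points. -/
theorem retriangulates_of_tiles {T : BaseTriangle} {c : List BoundarySegment} {i j k : Fin 3}
    (h : Frame i j k) (p q₁ q₂ q₃ q₄ : Plane) (τ : Template)
    {K : Finset (Finset Label)} (hT : Tiles (T.place i j k p q₁ q₂ q₃ q₄) K T.carrier)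
    (hK : τ.faces.toFinset.image faceFinset = K)
    (hinj : ∀ f ∈ τ.faces, ∀ g ∈ τ.faces, faceFinset f = faceFinset g → f = g)
    (habc : {A, B, C} ⊆ usedLabels τ.faces)
    (hp : p ∈ endPoints T c ∨ P ∉ usedLabels τ.faces)
    (hq₁ : q₁ ∈ crossingPoints T c ∨ Q1 ∉ usedLabels τ.faces)
    (hq₂ : q₂ ∈ crossingPoints T c ∨ Q2 ∉ usedLabels τ.faces)
    (hq₃ : q₃ ∈ crossingPoints T c ∨ Q3 ∉ usedLabels τ.faces)
    (hq₄ : q₄ ∈ crossingPoints T c ∨ Q4 ∉ usedLabels τ.faces)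
    (hedge : ∀ S ∈ c, IsFaceEdge T τ.faces (T.place i j k p q₁ q₂ q₃ q₄) S) :
    τ.Retriangulates T c := by
  subst hK
  set π := T.place i j k p q₁ q₂ q₃ q₄ with hπ
  have hA : A ∈ usedLabels τ.faces := habc (by simp)
  have hB : B ∈ usedLabels τ.faces := habc (by simp)
  have hC : C ∈ usedLabels τ.faces := habc (by simp)
  have hK : ∀ f ∈ τ.faces, faceFinset f ∈ τ.faces.toFinset.image faceFinset := fun f hf =>
    Finset.mem_image_of_mem _ (List.mem_toFinset.2 hf)
  have himg : Set.InjOn π τ.labels := by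
    refine hT.injOn.mono fun l hl => ?_
    obtain ⟨f, hf, hlf⟩ := hl
    exact ⟨faceFinset f, hK f hf, mem_faceLabels.1 hlf⟩
  have hull_eq : ∀ f, faceHull π f = hull π (faceFinset f) := fun f => by
    rw [faceHull, hull, coe_faceFinset]
  refine ⟨π, ⟨?_, ?_, ?_, himg, ?_⟩, ?_, ?_, ?_, ?_⟩
  · obtain ⟨s, rfl, rfl, rfl⟩ := h.exists_perm
    exact ⟨s, rfl, rfl, rfl⟩
  · intro hP
    exact hp.resolve_right (not_not.2 (Template.mem_labels.1 hP))
  · rintro q (rfl | rfl | rfl | rfl) hq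
    · exact hq₁.resolve_right (not_not.2 (Template.mem_labels.1 hq))
    · exact hq₂.resolve_right (not_not.2 (Template.mem_labels.1 hq))
    · exact hq₃.resolve_right (not_not.2 (Template.mem_labels.1 hq))
    · exact hq₄.resolve_right (not_not.2 (Template.mem_labels.1 hq))
  · apply Set.Subset.antisymm
    · rintro _ ⟨l, hl, rfl⟩
      have hl' := Template.mem_labels.1 hl
      cases l
      · exact Or.inl (Or.inl ⟨i, rfl⟩)
      · exact Or.inl (Or.inl ⟨j, rfl⟩)
      · exact Or.inl (Or.inl ⟨k, rfl⟩)
      · exact Or.inr (hp.resolve_right (not_not.2 hl'))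
      · exact Or.inl (Or.inr (hq₁.resolve_right (not_not.2 hl')))
      · exact Or.inl (Or.inr (hq₂.resolve_right (not_not.2 hl')))
      · exact Or.inl (Or.inr (hq₃.resolve_right (not_not.2 hl')))
      · exact Or.inl (Or.inr (hq₄.resolve_right (not_not.2 hl')))
    · rintro x ((hx | ⟨S, hS, l, hl⟩) | ⟨hx, S, hS, he⟩)
      · rw [h.range_vertex] at hx
        rcases hx with rfl | rfl | rfl
        · exact ⟨A, Template.mem_labels.2 hA, rfl⟩
        · exact ⟨B, Template.mem_labels.2 hB, rfl⟩
        · exact ⟨C, Template.mem_labels.2 hC, rfl⟩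
      · obtain ⟨u, v, ⟨f, hf, hu, hv⟩, e⟩ := hedge S hS
        rcases crossing_subset e hl with rfl | rfl
        · exact ⟨u, ⟨f, hf, mem_faceLabels.2 hu⟩, rfl⟩
        · exact ⟨v, ⟨f, hf, mem_faceLabels.2 hv⟩, rfl⟩
      · obtain ⟨u, v, ⟨f, hf, hu, hv⟩, e⟩ := hedge S hS
        rcases endpoint_trace e hx he with rfl | rfl
        · exact ⟨u, ⟨f, hf, mem_faceLabels.2 hu⟩, rfl⟩
        · exact ⟨v, ⟨f, hf, mem_faceLabels.2 hv⟩, rfl⟩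
  · intro f hf
    rw [affineIndependent_iff_not_collinear_set, ← image_triple]
    exact hT.indep _ (hK f hf)
  · rw [← hT.cover, Finset.set_biUnion_finset_image]
    simp only [hull_eq, List.mem_toFinset]
  · intro f hf g hg hne
    rw [hull_eq, hull_eq]
    have hsub : ∀ f ∈ τ.faces, faceLabels f ⊆ τ.labels := fun f hf l hl => ⟨f, hf, hl⟩
    rw [← himg.image_inter (hsub f hf) (hsub g hg)]
    apply Set.Subset.antisymm
    · refine (hT.inter _ (hK f hf) _ (hK g hg) fun e => hne (hinj f hf g hg e)).trans ?_
      rw [hull, Finset.coe_inter, coe_faceFinset, coe_faceFinset]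
    · rw [hull, hull, coe_faceFinset, coe_faceFinset]
      exact Set.subset_inter (convexHull_mono (Set.image_mono Set.inter_subset_left))
        (convexHull_mono (Set.image_mono Set.inter_subset_right))
  · intro S hS x hx
    obtain ⟨u, v, ⟨f, hf, hu, hv⟩, e⟩ := hedge S hS
    refine ⟨f, hf, u, mem_faceLabels.2 hu, v, mem_faceLabels.2 hv, e ▸ hx, ?_⟩
    rw [← e]
    exact Set.inter_subset_left

theorem mem_endPoints_swap {T : BaseTriangle} {S₁ S₂ : BoundarySegment} {p : Plane}
    (h : p ∈ endPoints T [S₁, S₂]) : p ∈ endPoints T [S₂, S₁] := by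
  obtain ⟨hp, S, hS, h⟩ := h
  refine ⟨hp, S, ?_, h⟩
  simp only [List.mem_cons, List.not_mem_nil, or_false] at hS ⊢
  exact hS.symm

theorem Covered.swap {T : BaseTriangle} {S₁ S₂ : BoundarySegment} (h : Covered T [S₁, S₂]) :
    Covered T [S₂, S₁] := by
  have hm : ∀ S, S ∈ [S₁, S₂] ↔ S ∈ [S₂, S₁] := fun S => by simp [or_comm]
  have h1 : configurationType T [S₁, S₂] = configurationType T [S₂, S₁] := by
    simp only [configurationType, countPair]
    rw [min_comm, max_comm]
  have h2 : endPoints T [S₁, S₂] = endPoints T [S₂, S₁] := by simp only [endPoints, hm]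
  have h3 : crossingPoints T [S₁, S₂] = crossingPoints T [S₂, S₁] := by
    simp only [crossingPoints, hm]
  obtain ⟨hc, τ, hτ, ht, π, ⟨p1, p2, p3, p4, p5⟩, r2, r3, r4, r5⟩ := h
  exact ⟨h1 ▸ hc, τ, hτ, ht.trans h1, π, ⟨p1, h2 ▸ p2, h3 ▸ p3, p4, by rw [p5, h2, h3]⟩,
    r2, r3, r4, fun S hS => r5 S ((hm S).2 hS)⟩

theorem forall_mem_one {S : BoundarySegment} {φ : BoundarySegment → Prop} (h : φ S) :
    ∀ S' ∈ [S], φ S' := by simpa using h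

theorem forall_mem_pair {S₁ S₂ : BoundarySegment} {φ : BoundarySegment → Prop} (h₁ : φ S₁)
    (h₂ : φ S₂) : ∀ S' ∈ [S₁, S₂], φ S' := by simpa using ⟨h₁, h₂⟩

/-- A single segment is covered if its trace is an edge in a placed template of the right type.
The purely combinatorial conditions on the template are decidable. -/
theorem covered_single_of_tiles {T : BaseTriangle} {S : BoundarySegment} {i j k : Fin 3}
    {p q₁ q₂ q₃ q₄ : Plane} {n : ℕ} {K : Finset (Finset Label)} (τ : Template) (h : Frame i j k)
    (hn : intersectionCount T S = n) (hT : Tiles (T.place i j k p q₁ q₂ q₃ q₄) K T.carrier)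
    (hedge : IsFaceEdge T τ.faces (T.place i j k p q₁ q₂ q₃ q₄) S)
    (hp : p ∈ endPoints T [S] ∨ P ∉ usedLabels τ.faces := by exact Or.inr (by decide))
    (hq₁ : q₁ ∈ crossingPoints T [S] ∨ Q1 ∉ usedLabels τ.faces := by exact Or.inr (by decide))
    (hq₂ : q₂ ∈ crossingPoints T [S] ∨ Q2 ∉ usedLabels τ.faces := by exact Or.inr (by decide))
    (hq₃ : q₃ ∈ crossingPoints T [S] ∨ Q3 ∉ usedLabels τ.faces := by exact Or.inr (by decide))
    (hq₄ : q₄ ∈ crossingPoints T [S] ∨ Q4 ∉ usedLabels τ.faces := by exact Or.inr (by decide))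
    (hτ : τ ∈ lookupTable := by simp [lookupTable]) (hc : τ.type ∈ canonicalTypes := by decide)
    (ht : τ.type = (0, n) := by rfl) (hK : τ.faces.toFinset.image faceFinset = K := by decide)
    (hinj : ∀ f ∈ τ.faces, ∀ g ∈ τ.faces, faceFinset f = faceFinset g → f = g := by decide)
    (habc : {A, B, C} ⊆ usedLabels τ.faces := by decide) : Covered T [S] := by
  have : configurationType T [S] = τ.type := by simp [configurationType, countPair, hn, ht]
  exact ⟨this ▸ hc, τ, hτ, this.symm,
    retriangulates_of_tiles h p q₁ q₂ q₃ q₄ τ hT hK hinj habc hp hq₁ hq₂ hq₃ hq₄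
      (forall_mem_one hedge)⟩

/-- Two segments are covered if their traces are edges in a placed template of the right type. -/
theorem covered_pair_of_tiles {T : BaseTriangle} {S₁ S₂ : BoundarySegment} {i j k : Fin 3}
    {p q₁ q₂ q₃ q₄ : Plane} {n₁ n₂ : ℕ} {K : Finset (Finset Label)} (τ : Template)
    (h : Frame i j k) (hn₁ : intersectionCount T S₁ = n₁) (hn₂ : intersectionCount T S₂ = n₂)
    (hT : Tiles (T.place i j k p q₁ q₂ q₃ q₄) K T.carrier)
    (hedge₁ : IsFaceEdge T τ.faces (T.place i j k p q₁ q₂ q₃ q₄) S₁)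
    (hedge₂ : IsFaceEdge T τ.faces (T.place i j k p q₁ q₂ q₃ q₄) S₂)
    (hp : p ∈ endPoints T [S₁, S₂] ∨ P ∉ usedLabels τ.faces := by exact Or.inr (by decide))
    (hq₁ : q₁ ∈ crossingPoints T [S₁, S₂] ∨ Q1 ∉ usedLabels τ.faces := by
      exact Or.inr (by decide))
    (hq₂ : q₂ ∈ crossingPoints T [S₁, S₂] ∨ Q2 ∉ usedLabels τ.faces := by
      exact Or.inr (by decide))
    (hq₃ : q₃ ∈ crossingPoints T [S₁, S₂] ∨ Q3 ∉ usedLabels τ.faces := by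
      exact Or.inr (by decide))
    (hq₄ : q₄ ∈ crossingPoints T [S₁, S₂] ∨ Q4 ∉ usedLabels τ.faces := by
      exact Or.inr (by decide))
    (hτ : τ ∈ lookupTable := by simp [lookupTable]) (hc : τ.type ∈ canonicalTypes := by decide)
    (ht : τ.type = (min n₁ n₂, max n₁ n₂) := by rfl)
    (hK : τ.faces.toFinset.image faceFinset = K := by decide)
    (hinj : ∀ f ∈ τ.faces, ∀ g ∈ τ.faces, faceFinset f = faceFinset g → f = g := by decide)
    (habc : {A, B, C} ⊆ usedLabels τ.faces := by decide) : Covered T [S₁, S₂] := by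
  have : configurationType T [S₁, S₂] = τ.type := by
    simp [configurationType, countPair, hn₁, hn₂, ht]
  exact ⟨this ▸ hc, τ, hτ, this.symm,
    retriangulates_of_tiles h p q₁ q₂ q₃ q₄ τ hT hK hinj habc hp hq₁ hq₂ hq₃ hq₄
      (forall_mem_pair hedge₁ hedge₂)⟩

/-! ### Strata of the triangle -/

namespace BaseTriangle

variable (T : BaseTriangle)

/-- The point lies in the relative interior of the side opposite to the vertex `l`. -/
def OnSide (l : Fin 3) (p : Plane) : Prop := T.coord l p = 0 ∧ ∀ m, m ≠ l → 0 < T.coord m p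

/-- The point lies in the interior of the triangle. -/
def Inside (p : Plane) : Prop := ∀ l, 0 < T.coord l p

end BaseTriangle

section

variable {T : BaseTriangle} {i j k : Fin 3} {p q : Plane}

theorem Frame.onSide (h : Frame i j k) (hj : T.coord j p = 0) (hi : 0 < T.coord i p)
    (hk : 0 < T.coord k p) : T.OnSide j p := by
  refine ⟨hj, fun m hm => ?_⟩
  rcases h.eq_or m with rfl | rfl | rfl
  exacts [hi, absurd rfl hm, hk]

theorem Frame.mem_openSegment_of_onSide (h : Frame i j k) (hp : T.OnSide j p) :
    p ∈ openSegment ℝ (T.vertex i) (T.vertex k) := by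
  have hs := h.sum_coord T p
  have hi := hp.2 i h.ij
  have hk := hp.2 k h.jk.symm
  refine h.mem_openSegment T ?_ ?_ ?_ ?_
  · rw [T.coord_vertex_ne h.ij.symm, hp.1]
  · rw [T.coord_vertex_ne h.jk, hp.1]
  · rwa [T.coord_vertex_ne h.ik.symm]
  · rw [T.coord_vertex_self]; linarith [hp.1]

/-- The points of a side between a given point and the vertex `k`. -/
theorem Frame.mem_openSegment_vertex (h : Frame i j k) (hp : T.OnSide j p) (hq : T.OnSide j q)
    (hpq : T.coord k p < T.coord k q) : q ∈ openSegment ℝ p (T.vertex k) := by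
  have hs := h.sum_coord T q
  have hi := hq.2 i h.ij
  refine h.mem_openSegment T (hp.1.trans hq.1.symm) ?_ hpq ?_
  · rw [T.coord_vertex_ne h.jk, hq.1]
  · rw [T.coord_vertex_self]; linarith [hq.1]

theorem Frame.coord_lt_iff_of_onSide (h : Frame i j k) (hp : T.OnSide j p) (hq : T.OnSide j q) :
    T.coord k p < T.coord k q ↔ T.coord i q < T.coord i p := by
  have h1 := h.sum_coord T p
  have h2 := h.sum_coord T q
  have h3 := hp.1
  have h4 := hq.1
  constructor <;> intro <;> linarith

theorem Frame.tiles_triangle (h : Frame i j k) (T : BaseTriangle) (p q₁ q₂ q₃ q₄ : Plane) :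
    Tiles (T.place i j k p q₁ q₂ q₃ q₄) {{A, B, C}} T.carrier := by
  rw [h.carrier_eq T]
  exact SBMT.tiles_triangle (π := T.place i j k p q₁ q₂ q₃ q₄) (h.not_collinear T)

theorem Frame.tiles_interior (h : Frame i j k) (hp : T.Inside p) (q₁ q₂ q₃ q₄ : Plane) :
    Tiles (T.place i j k p q₁ q₂ q₃ q₄) {{A, B, P}, {B, C, P}, {C, A, P}} T.carrier := by
  rw [h.carrier_eq T]
  exact SBMT.tiles_interior (π := T.place i j k p q₁ q₂ q₃ q₄) (h.not_collinear T) (hp i) (hp j)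
    (hp k) (h.sum_coord T p) (h.combo_eq T p).symm

end

/-! ### Counts of traces -/

section Count

variable {T : BaseTriangle} {S : BoundarySegment} {p q : Plane} {i j k : Fin 3}

theorem count_vertex (hS : S.carrier ∩ T.carrier = segment ℝ (T.vertex i) (T.vertex i)) :
    intersectionCount T S = 2 := by
  obtain ⟨j, k, h⟩ := Frame.exists_of_index i
  simp [count_trace hS h, T.coord_vertex_self, T.coord_vertex_ne h.ij.symm,
    T.coord_vertex_ne h.ik.symm]

theorem count_vertex_vertex (hij : i ≠ j)
    (hS : S.carrier ∩ T.carrier = segment ℝ (T.vertex i) (T.vertex j)) :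
    intersectionCount T S = 3 := by
  obtain ⟨k, h⟩ := Frame.exists_third hij
  simp [count_trace hS h, T.coord_vertex_ne h.ij, T.coord_vertex_ne h.ij.symm,
    T.coord_vertex_ne h.ik.symm]

theorem count_vertex_side (hq : T.OnSide i q)
    (hS : S.carrier ∩ T.carrier = segment ℝ (T.vertex i) q) : intersectionCount T S = 3 := by
  obtain ⟨j, k, h⟩ := Frame.exists_of_index i
  simp [count_trace hS h, T.coord_vertex_ne h.ij.symm, T.coord_vertex_ne h.ik.symm, hq.1]

theorem count_side_side (hij : i ≠ j) (hp : T.OnSide i p) (hq : T.OnSide j q)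
    (hS : S.carrier ∩ T.carrier = segment ℝ p q) : intersectionCount T S = 2 := by
  obtain ⟨k, h⟩ := Frame.exists_third hij
  simp [count_trace hS h, hp.1, hq.1, (hp.2 k h.ik.symm).ne', (hq.2 k h.jk.symm).ne']

theorem count_side (hp : T.OnSide i p) (hS : S.carrier ∩ T.carrier = segment ℝ p p) :
    intersectionCount T S = 1 := by
  obtain ⟨j, k, h⟩ := Frame.exists_of_index i
  simp [count_trace hS h, hp.1, (hp.2 k h.ik.symm).ne', (hp.2 j h.ij.symm).ne']

theorem count_side_vertex (hij : i ≠ j) (hp : T.OnSide j p)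
    (hS : S.carrier ∩ T.carrier = segment ℝ p (T.vertex i)) : intersectionCount T S = 2 := by
  obtain ⟨k, h⟩ := Frame.exists_third hij
  simp [count_trace hS h, hp.1, (hp.2 i h.ij).ne', T.coord_vertex_self,
    T.coord_vertex_ne h.ik.symm]

theorem count_inside_vertex (hp : T.Inside p)
    (hS : S.carrier ∩ T.carrier = segment ℝ p (T.vertex i)) : intersectionCount T S = 2 := by
  obtain ⟨j, k, h⟩ := Frame.exists_of_index i
  simp [count_trace hS h, (hp i).ne', T.coord_vertex_self, T.coord_vertex_ne h.ij.symm,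
    T.coord_vertex_ne h.ik.symm]

theorem count_inside_side (hp : T.Inside p) (hq : T.OnSide i q)
    (hS : S.carrier ∩ T.carrier = segment ℝ p q) : intersectionCount T S = 1 := by
  obtain ⟨j, k, h⟩ := Frame.exists_of_index i
  simp [count_trace hS h, (hp i).ne', (hp j).ne', (hp k).ne', hq.1, (hq.2 j h.ij.symm).ne',
    (hq.2 k h.ik.symm).ne']

/-- The far end of a trace on a side is an intersection point if the near end is not on the line of
that side. -/
theorem crossing_right {c : List BoundarySegment} (hSc : S ∈ c)
    (hS : S.carrier ∩ T.carrier = segment ℝ p q) (hq : T.OnSide i q) (hp : 0 < T.coord i p) :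
    q ∈ crossingPoints T c :=
  ⟨S, hSc, right_crossing hS hq.1 (Or.inl hp)⟩

theorem crossing_left {c : List BoundarySegment} (hSc : S ∈ c)
    (hS : S.carrier ∩ T.carrier = segment ℝ p q) (hp : T.OnSide i p) (hq : 0 < T.coord i q) :
    p ∈ crossingPoints T c :=
  ⟨S, hSc, left_crossing hS hp.1 (Or.inl hq)⟩

end Count

/-! ### Covering the configurations

Each lemma below treats one position of the traces up to symmetry, with `A, B, C` the vertices
`i, j, k`. For a pair of segments with a common endpoint `p` in the triangle the name lists the
stratum of `p` (`inside` or `side`) and then the behaviour of the two segments: from a point `p` of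
a side a segment may leave the triangle at once (`stay`), at an end of that side (`end`), at the
opposite vertex (`opposite`) or on another side (`side`). Names with `and` concern two disjoint
traces, or traces which have a vertex of the triangle in common. -/

section

variable {T : BaseTriangle} {i j k : Fin 3} {p q r q' r' : Plane}

/-- A trace from the label `u` to a vertex is an edge if `u` is joined to all three vertices. -/
theorem isFaceEdge_vertex {S : BoundarySegment} (h : Frame i j k) {p q₁ q₂ q₃ q₄ : Plane}
    {L : List (Label × Label × Label)} (m : Fin 3) (u : Label)
    (hS : S.carrier ∩ T.carrier = segment ℝ (T.place i j k p q₁ q₂ q₃ q₄ u) (T.vertex m))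
    (hL : ∀ v ∈ [A, B, C], ∃ f ∈ L, u ∈ faceFinset f ∧ v ∈ faceFinset f := by decide) :
    IsFaceEdge T L (T.place i j k p q₁ q₂ q₃ q₄) S := by
  rcases h.eq_or m with rfl | rfl | rfl
  · exact ⟨u, A, hL A (by simp), hS⟩
  · exact ⟨u, B, hL B (by simp), hS⟩
  · exact ⟨u, C, hL C (by simp), hS⟩

/-- A trace from the label `u` to an end of the side `A C` is an edge if `u` is joined to `A` and
`C`. -/
theorem isFaceEdge_vertex_of_ne {S : BoundarySegment} (h : Frame i j k) {p q₁ q₂ q₃ q₄ : Plane}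
    {L : List (Label × Label × Label)} (m : Fin 3) (hm : m ≠ j) (u : Label)
    (hS : S.carrier ∩ T.carrier = segment ℝ (T.place i j k p q₁ q₂ q₃ q₄ u) (T.vertex m))
    (hA : ∃ f ∈ L, u ∈ faceFinset f ∧ A ∈ faceFinset f := by decide)
    (hC : ∃ f ∈ L, u ∈ faceFinset f ∧ C ∈ faceFinset f := by decide) :
    IsFaceEdge T L (T.place i j k p q₁ q₂ q₃ q₄) S := by
  rcases h.eq_or m with rfl | rfl | rfl
  · exact ⟨u, A, hA, hS⟩
  · exact absurd rfl hm
  · exact ⟨u, C, hC, hS⟩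

theorem isFaceEdge_vertex_self {S : BoundarySegment} (h : Frame i j k) {p q₁ q₂ q₃ q₄ : Plane}
    {L : List (Label × Label × Label)} (m : Fin 3)
    (hS : S.carrier ∩ T.carrier = segment ℝ (T.vertex m) (T.vertex m))
    (hL : ∀ v ∈ [A, B, C], ∃ f ∈ L, v ∈ faceFinset f := by decide) :
    IsFaceEdge T L (T.place i j k p q₁ q₂ q₃ q₄) S := by
  have key : ∀ v ∈ [A, B, C], ∃ f ∈ L, v ∈ faceFinset f ∧ v ∈ faceFinset f := fun v hv => by
    obtain ⟨f, hf, h⟩ := hL v hv; exact ⟨f, hf, h, h⟩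
  rcases h.eq_or m with rfl | rfl | rfl
  · exact ⟨A, A, key A (by simp), hS⟩
  · exact ⟨B, B, key B (by simp), hS⟩
  · exact ⟨C, C, key C (by simp), hS⟩

theorem BaseTriangle.coord_vertex_pos (T : BaseTriangle) (i : Fin 3) :
    0 < T.coord i (T.vertex i) := by
  rw [T.coord_vertex_self]; exact one_pos

theorem Frame.tiles_medial (h : Frame i j k) (p q₁ q₂ q₃ q₄ : Plane) (r s t : Label)
    (hr : T.OnSide k (T.place i j k p q₁ q₂ q₃ q₄ r))
    (hs : T.OnSide i (T.place i j k p q₁ q₂ q₃ q₄ s))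
    (ht : T.OnSide j (T.place i j k p q₁ q₂ q₃ q₄ t)) :
    Tiles (T.place i j k p q₁ q₂ q₃ q₄) {{A, r, t}, {B, s, r}, {C, t, s}, {r, s, t}}
      T.carrier := by
  rw [h.carrier_eq T]
  exact SBMT.tiles_medial (π := T.place i j k p q₁ q₂ q₃ q₄) (x := A) (y := B) (z := C)
    (h.not_collinear T) (h.rotate.rotate.swap.mem_openSegment_of_onSide hr)
    (h.swap.mem_openSegment_of_onSide hs) (h.reverse.mem_openSegment_of_onSide ht)

theorem covered_vertex {S : BoundarySegment} (h : Frame i j k)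
    (hS : S.carrier ∩ T.carrier = segment ℝ (T.vertex i) (T.vertex i)) :
    Covered T [S] :=
  covered_single_of_tiles
    ⟨(0, 2), [(A, B, C)]⟩
    h (count_vertex hS)
    (h.tiles_triangle T 0 0 0 0 0)
    ⟨A, A, by decide, hS⟩

theorem covered_vertex_vertex {S : BoundarySegment} (h : Frame i j k)
    (hS : S.carrier ∩ T.carrier = segment ℝ (T.vertex i) (T.vertex j)) :
    Covered T [S] :=
  covered_single_of_tiles
    ⟨(0, 3), [(A, B, C)]⟩
    h (count_vertex_vertex h.ij hS)
    (h.tiles_triangle T 0 0 0 0 0)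
    ⟨A, B, by decide, hS⟩

theorem covered_vertex_side {S : BoundarySegment} (h : Frame i j k)
    (hq : T.OnSide i q) (hS : S.carrier ∩ T.carrier = segment ℝ (T.vertex i) q) :
    Covered T [S] :=
  covered_single_of_tiles
    ⟨(0, 3), [(A, Q1, C), (A, B, Q1)]⟩
    h (count_vertex_side hq hS)
    (h.tiles_triangle T 0 q 0 0 0
      |>.split_edge B C A Q1 (h.swap.mem_openSegment_of_onSide hq))
    ⟨A, Q1, by decide, hS⟩ (hq₁ := .inl (crossing_right (by simp) hS hq (T.coord_vertex_pos i)))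

theorem covered_side_side {S : BoundarySegment} (h : Frame i j k)
    (hp : T.OnSide i p) (hq : T.OnSide j q) (hS : S.carrier ∩ T.carrier = segment ℝ p q) :
    Covered T [S] :=
  covered_single_of_tiles
    ⟨(0, 2), [(Q2, Q1, C), (Q2, A, B), (Q1, Q2, B)]⟩
    h (count_side_side h.ij hp hq hS)
    (h.tiles_triangle T 0 p q 0 0
      |>.split_edge A C B Q2 (h.mem_openSegment_of_onSide hq)
      |>.split_edge B C Q2 Q1 (h.swap.mem_openSegment_of_onSide hp))
    ⟨Q1, Q2, by decide, hS⟩ (hq₁ := .inl (crossing_left (by simp) hS hp (hq.2 i h.ij)))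
    (hq₂ := .inl (crossing_right (by simp) hS hq (hp.2 j h.ij.symm)))

theorem covered_side {S : BoundarySegment} (h : Frame i j k)
    (hp : T.OnSide j p) (hP : p ∈ endPoints T [S]) (hS : S.carrier ∩ T.carrier = segment ℝ p p) :
    Covered T [S] :=
  covered_single_of_tiles
    ⟨(0, 1), [(C, P, B), (P, A, B)]⟩
    h (count_side hp hS)
    (h.tiles_triangle T p 0 0 0 0
      |>.split_edge A C B P (h.mem_openSegment_of_onSide hp))
    ⟨P, P, by decide, hS⟩ (hp := .inl hP)

theorem covered_side_vertex {S : BoundarySegment} (h : Frame i j k)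
    (hp : T.OnSide j p) (hP : p ∈ endPoints T [S])
    (hS : S.carrier ∩ T.carrier = segment ℝ p (T.vertex i)) :
    Covered T [S] :=
  covered_single_of_tiles
    ⟨(0, 2), [(A, B, P), (B, C, P)]⟩
    h (count_side_vertex h.ij hp hS)
    (h.tiles_triangle T p 0 0 0 0
      |>.split_edge A C B P (h.mem_openSegment_of_onSide hp))
    ⟨P, A, by decide, hS⟩ (hp := .inl hP)

theorem covered_inside_vertex {S : BoundarySegment} (h : Frame i j k)
    (hp : T.Inside p) (hP : p ∈ endPoints T [S])
    (hS : S.carrier ∩ T.carrier = segment ℝ p (T.vertex i)) :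
    Covered T [S] :=
  covered_single_of_tiles
    ⟨(0, 2), [(C, A, P), (A, B, P), (C, P, B)]⟩
    h (count_inside_vertex hp hS)
    (h.tiles_interior hp 0 0 0 0)
    ⟨P, A, by decide, hS⟩ (hp := .inl hP)

theorem covered_inside_side {S : BoundarySegment} (h : Frame i j k)
    (hp : T.Inside p) (hq : T.OnSide j q) (hP : p ∈ endPoints T [S])
    (hS : S.carrier ∩ T.carrier = segment ℝ p q) :
    Covered T [S] :=
  covered_single_of_tiles
    ⟨(0, 1), [(A, P, Q1), (C, Q1, P), (C, P, B), (A, B, P)]⟩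
    h (count_inside_side hp hq hS)
    (h.tiles_interior hp q 0 0 0
      |>.split_edge A C P Q1 (h.mem_openSegment_of_onSide hq))
    ⟨P, Q1, by decide, hS⟩ (hp := .inl hP) (hq₁ := .inl (crossing_right (by simp) hS hq (hp j)))

theorem covered_inside_side_side {S₁ S₂ : BoundarySegment} (h : Frame i j k)
    (hp : T.Inside p) (hq : T.OnSide j q) (hr : T.OnSide i r)
    (hP : p ∈ endPoints T [S₁, S₂])
    (hS₁ : S₁.carrier ∩ T.carrier = segment ℝ p q)
    (hS₂ : S₂.carrier ∩ T.carrier = segment ℝ p r) :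
    Covered T [S₁, S₂] :=
  covered_pair_of_tiles
    ⟨(1, 1), [(Q1, P, C), (P, Q2, C), (Q1, A, P), (A, B, P), (Q2, P, B)]⟩
    h (count_inside_side hp hq hS₁) (count_inside_side hp hr hS₂)
    (h.tiles_interior hp q r 0 0
      |>.split_edge A C P Q1 (h.mem_openSegment_of_onSide hq)
      |>.split_edge B C P Q2 (h.swap.mem_openSegment_of_onSide hr))
    ⟨P, Q1, by decide, hS₁⟩ ⟨P, Q2, by decide, hS₂⟩ (hp := .inl hP)
    (hq₁ := .inl (crossing_right (by simp) hS₁ hq (hp j)))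
    (hq₂ := .inl (crossing_right (by simp) hS₂ hr (hp i)))

/-- Two segments from an interior point leaving through the same side. -/
theorem covered_inside_same_side {S₁ S₂ : BoundarySegment} (h : Frame i j k)
    (hp : T.Inside p) (hq : T.OnSide j q) (hr : T.OnSide j r)
    (hqr : T.coord i q < T.coord i r) (hP : p ∈ endPoints T [S₁, S₂])
    (hS₁ : S₁.carrier ∩ T.carrier = segment ℝ p q)
    (hS₂ : S₂.carrier ∩ T.carrier = segment ℝ p r) :
    Covered T [S₁, S₂] :=
  covered_pair_of_tiles
    ⟨(1, 1), [(Q1, P, C), (P, Q1, Q2), (Q2, A, P), (B, C, P), (A, B, P)]⟩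
    h (count_inside_side hp hq hS₁) (count_inside_side hp hr hS₂)
    (h.tiles_interior hp q r 0 0
      |>.split_edge A C P Q1 (h.mem_openSegment_of_onSide hq)
      |>.split_edge Q1 A P Q2 (h.reverse.mem_openSegment_vertex hq hr hqr))
    ⟨P, Q1, by decide, hS₁⟩ ⟨P, Q2, by decide, hS₂⟩ (hp := .inl hP)
    (hq₁ := .inl (crossing_right (by simp) hS₁ hq (hp j)))
    (hq₂ := .inl (crossing_right (by simp) hS₂ hr (hp j)))

/-- Only the side is normalised: an interior point is joined to all three vertices `m`. -/
theorem covered_inside_vertex_side {S₁ S₂ : BoundarySegment} (h : Frame i j k)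
    (m : Fin 3) (hp : T.Inside p) (hq : T.OnSide j q)
    (hP : p ∈ endPoints T [S₁, S₂])
    (hS₁ : S₁.carrier ∩ T.carrier = segment ℝ p (T.vertex m))
    (hS₂ : S₂.carrier ∩ T.carrier = segment ℝ p q) :
    Covered T [S₁, S₂] :=
  covered_pair_of_tiles
    ⟨(1, 2), [(A, P, Q1), (C, Q1, P), (C, P, B), (A, B, P)]⟩
    h (count_inside_vertex hp hS₁) (count_inside_side hp hq hS₂)
    (h.tiles_interior hp q 0 0 0
      |>.split_edge A C P Q1 (h.mem_openSegment_of_onSide hq))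
    (isFaceEdge_vertex h m P hS₁) ⟨P, Q1, by decide, hS₂⟩ (hp := .inl hP)
    (hq₁ := .inl (crossing_right (by simp) hS₂ hq (hp j)))

theorem covered_inside_vertex_vertex {S₁ S₂ : BoundarySegment} (h : Frame i j k)
    (m n : Fin 3) (hp : T.Inside p)
    (hP : p ∈ endPoints T [S₁, S₂])
    (hS₁ : S₁.carrier ∩ T.carrier = segment ℝ p (T.vertex m))
    (hS₂ : S₂.carrier ∩ T.carrier = segment ℝ p (T.vertex n)) :
    Covered T [S₁, S₂] :=
  covered_pair_of_tiles
    ⟨(2, 2), [(C, A, P), (A, B, P), (C, P, B)]⟩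
    h (count_inside_vertex hp hS₁) (count_inside_vertex hp hS₂)
    (h.tiles_interior hp 0 0 0 0)
    (isFaceEdge_vertex h m P hS₁) (isFaceEdge_vertex h n P hS₂) (hp := .inl hP)

theorem covered_side_stay_stay {S₁ S₂ : BoundarySegment} (h : Frame i j k)
    (hp : T.OnSide j p) 
    (hP : p ∈ endPoints T [S₁, S₂])
    (hS₁ : S₁.carrier ∩ T.carrier = segment ℝ p p)
    (hS₂ : S₂.carrier ∩ T.carrier = segment ℝ p p) :
    Covered T [S₁, S₂] :=
  covered_pair_of_tiles
    ⟨(1, 1), [(C, P, B), (P, A, B)]⟩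
    h (count_side hp hS₁) (count_side hp hS₂)
    (h.tiles_triangle T p 0 0 0 0
      |>.split_edge A C B P (h.mem_openSegment_of_onSide hp))
    ⟨P, P, by decide, hS₁⟩ ⟨P, P, by decide, hS₂⟩ (hp := .inl hP)

theorem covered_side_stay_end {S₁ S₂ : BoundarySegment} (h : Frame i j k)
    (hp : T.OnSide j p) 
    (hP : p ∈ endPoints T [S₁, S₂])
    (hS₁ : S₁.carrier ∩ T.carrier = segment ℝ p p)
    (hS₂ : S₂.carrier ∩ T.carrier = segment ℝ p (T.vertex i)) :
    Covered T [S₁, S₂] :=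
  covered_pair_of_tiles
    ⟨(1, 2), [(A, B, P), (B, C, P)]⟩
    h (count_side hp hS₁) (count_side_vertex h.ij hp hS₂)
    (h.tiles_triangle T p 0 0 0 0
      |>.split_edge A C B P (h.mem_openSegment_of_onSide hp))
    ⟨P, P, by decide, hS₁⟩ ⟨P, A, by decide, hS₂⟩ (hp := .inl hP)

theorem covered_side_stay_opposite {S₁ S₂ : BoundarySegment} (h : Frame i j k)
    (hp : T.OnSide j p) 
    (hP : p ∈ endPoints T [S₁, S₂])
    (hS₁ : S₁.carrier ∩ T.carrier = segment ℝ p p)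
    (hS₂ : S₂.carrier ∩ T.carrier = segment ℝ p (T.vertex j)) :
    Covered T [S₁, S₂] :=
  covered_pair_of_tiles
    ⟨(1, 3), [(A, B, P), (P, B, C)]⟩
    h (count_side hp hS₁) (count_vertex_side hp (hS₂.trans (segment_symm ℝ _ _)))
    (h.tiles_triangle T p 0 0 0 0
      |>.split_edge A C B P (h.mem_openSegment_of_onSide hp))
    ⟨P, P, by decide, hS₁⟩ ⟨P, B, by decide, hS₂⟩ (hp := .inl hP)

theorem covered_side_stay_side {S₁ S₂ : BoundarySegment} (h : Frame i j k)
    (hp : T.OnSide j p) (hq : T.OnSide i q)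
    (hP : p ∈ endPoints T [S₁, S₂])
    (hS₁ : S₁.carrier ∩ T.carrier = segment ℝ p p)
    (hS₂ : S₂.carrier ∩ T.carrier = segment ℝ p q) :
    Covered T [S₁, S₂] :=
  covered_pair_of_tiles
    ⟨(1, 2), [(P, Q1, C), (B, Q1, P), (A, B, P)]⟩
    h (count_side hp hS₁) (count_side_side h.ij.symm hp hq hS₂)
    (h.tiles_triangle T p q 0 0 0
      |>.split_edge A C B P (h.mem_openSegment_of_onSide hp)
      |>.split_edge B C P Q1 (h.swap.mem_openSegment_of_onSide hq))
    ⟨P, P, by decide, hS₁⟩ ⟨P, Q1, by decide, hS₂⟩ (hp := .inl hP)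
    (hq₁ := .inl (crossing_right (by simp) hS₂ hq (hp.2 i h.ij)))

theorem covered_side_end_end {S₁ S₂ : BoundarySegment} (h : Frame i j k)
    (hp : T.OnSide j p) 
    (hP : p ∈ endPoints T [S₁, S₂])
    (hS₁ : S₁.carrier ∩ T.carrier = segment ℝ p (T.vertex i))
    (hS₂ : S₂.carrier ∩ T.carrier = segment ℝ p (T.vertex k)) :
    Covered T [S₁, S₂] :=
  covered_pair_of_tiles
    ⟨(2, 2), [(B, C, P), (A, B, P)]⟩
    h (count_side_vertex h.ij hp hS₁) (count_side_vertex h.jk.symm hp hS₂)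
    (h.tiles_triangle T p 0 0 0 0
      |>.split_edge A C B P (h.mem_openSegment_of_onSide hp))
    ⟨P, A, by decide, hS₁⟩ ⟨P, C, by decide, hS₂⟩ (hp := .inl hP)

theorem covered_side_end_opposite {S₁ S₂ : BoundarySegment} (h : Frame i j k)
    (hp : T.OnSide j p) 
    (hP : p ∈ endPoints T [S₁, S₂])
    (hS₁ : S₁.carrier ∩ T.carrier = segment ℝ p (T.vertex i))
    (hS₂ : S₂.carrier ∩ T.carrier = segment ℝ p (T.vertex j)) :
    Covered T [S₁, S₂] :=
  covered_pair_of_tiles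
    ⟨(2, 3), [(A, B, P), (P, B, C)]⟩
    h (count_side_vertex h.ij hp hS₁) (count_vertex_side hp (hS₂.trans (segment_symm ℝ _ _)))
    (h.tiles_triangle T p 0 0 0 0
      |>.split_edge A C B P (h.mem_openSegment_of_onSide hp))
    ⟨P, A, by decide, hS₁⟩ ⟨P, B, by decide, hS₂⟩ (hp := .inl hP)

theorem covered_side_end_side {S₁ S₂ : BoundarySegment} (h : Frame i j k)
    (hp : T.OnSide j p) (m : Fin 3) (hm : m ≠ j) (hq : T.OnSide i q)
    (hP : p ∈ endPoints T [S₁, S₂])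
    (hS₁ : S₁.carrier ∩ T.carrier = segment ℝ p (T.vertex m))
    (hS₂ : S₂.carrier ∩ T.carrier = segment ℝ p q) :
    Covered T [S₁, S₂] :=
  covered_pair_of_tiles
    ⟨(2, 2), [(P, Q1, C), (B, Q1, P), (A, B, P)]⟩
    h (count_side_vertex hm hp hS₁) (count_side_side h.ij.symm hp hq hS₂)
    (h.tiles_triangle T p q 0 0 0
      |>.split_edge A C B P (h.mem_openSegment_of_onSide hp)
      |>.split_edge B C P Q1 (h.swap.mem_openSegment_of_onSide hq))
    (isFaceEdge_vertex_of_ne h m hm P hS₁) ⟨P, Q1, by decide, hS₂⟩ (hp := .inl hP)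
    (hq₁ := .inl (crossing_right (by simp) hS₂ hq (hp.2 i h.ij)))

theorem covered_side_opposite_side {S₁ S₂ : BoundarySegment} (h : Frame i j k)
    (hp : T.OnSide j p) (hq : T.OnSide i q)
    (hP : p ∈ endPoints T [S₁, S₂])
    (hS₁ : S₁.carrier ∩ T.carrier = segment ℝ p (T.vertex j))
    (hS₂ : S₂.carrier ∩ T.carrier = segment ℝ p q) :
    Covered T [S₁, S₂] :=
  covered_pair_of_tiles
    ⟨(2, 3), [(A, B, P), (P, B, Q1), (P, Q1, C)]⟩
    h (count_vertex_side hp (hS₁.trans (segment_symm ℝ _ _))) (count_side_side h.ij.symm hp hq hS₂)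
    (h.tiles_triangle T p q 0 0 0
      |>.split_edge A C B P (h.mem_openSegment_of_onSide hp)
      |>.split_edge B C P Q1 (h.swap.mem_openSegment_of_onSide hq))
    ⟨P, B, by decide, hS₁⟩ ⟨P, Q1, by decide, hS₂⟩ (hp := .inl hP)
    (hq₁ := .inl (crossing_right (by simp) hS₂ hq (hp.2 i h.ij)))

/-- Two segments from a point of a side leaving through the same other side. -/
theorem covered_side_same_side {S₁ S₂ : BoundarySegment} (h : Frame i j k)
    (hp : T.OnSide j p) (hq : T.OnSide i q) (hr : T.OnSide i r)
    (hqr : T.coord j q < T.coord j r)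
    (hP : p ∈ endPoints T [S₁, S₂])
    (hS₁ : S₁.carrier ∩ T.carrier = segment ℝ p q)
    (hS₂ : S₂.carrier ∩ T.carrier = segment ℝ p r) :
    Covered T [S₁, S₂] :=
  covered_pair_of_tiles
    ⟨(2, 2), [(P, Q1, C), (P, Q2, Q1), (P, A, B), (P, B, Q2)]⟩
    h (count_side_side h.ij.symm hp hq hS₁) (count_side_side h.ij.symm hp hr hS₂)
    (h.tiles_triangle T p q r 0 0
      |>.split_edge A C B P (h.mem_openSegment_of_onSide hp)
      |>.split_edge C B P Q1 (h.rotate.rotate.mem_openSegment_of_onSide hq)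
      |>.split_edge Q1 B P Q2 (h.rotate.rotate.mem_openSegment_vertex hq hr hqr))
    ⟨P, Q1, by decide, hS₁⟩ ⟨P, Q2, by decide, hS₂⟩ (hp := .inl hP)
    (hq₁ := .inl (crossing_right (by simp) hS₁ hq (hp.2 i h.ij)))
    (hq₂ := .inl (crossing_right (by simp) hS₂ hr (hp.2 i h.ij)))

/-- Two segments from a point of a side leaving through the other two sides. -/
theorem covered_side_side_side {S₁ S₂ : BoundarySegment} (h : Frame i j k)
    (hp : T.OnSide j p) (hq : T.OnSide k q) (hr : T.OnSide i r)
    (hP : p ∈ endPoints T [S₁, S₂])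
    (hS₁ : S₁.carrier ∩ T.carrier = segment ℝ p q)
    (hS₂ : S₂.carrier ∩ T.carrier = segment ℝ p r) :
    Covered T [S₁, S₂] :=
  covered_pair_of_tiles
    ⟨(2, 2), [(A, Q1, P), (P, Q2, C), (P, Q1, Q2), (Q1, B, Q2)]⟩
    h (count_side_side h.jk hp hq hS₁) (count_side_side h.ij.symm hp hr hS₂)
    (h.tiles_medial p q r 0 0 Q1 Q2 P hq hr hp)
    ⟨P, Q1, by decide, hS₁⟩ ⟨P, Q2, by decide, hS₂⟩ (hp := .inl hP)
    (hq₁ := .inl (crossing_right (by simp) hS₁ hq (hp.2 k h.jk.symm)))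
    (hq₂ := .inl (crossing_right (by simp) hS₂ hr (hp.2 i h.ij)))

theorem covered_vertex_and_vertex {S₁ S₂ : BoundarySegment} (h : Frame i j k)
    (m n : Fin 3)
    (hS₁ : S₁.carrier ∩ T.carrier = segment ℝ (T.vertex m) (T.vertex m))
    (hS₂ : S₂.carrier ∩ T.carrier = segment ℝ (T.vertex n) (T.vertex n)) :
    Covered T [S₁, S₂] :=
  covered_pair_of_tiles
    ⟨(2, 2), [(A, B, C)]⟩
    h (count_vertex hS₁) (count_vertex hS₂)
    (h.tiles_triangle T 0 0 0 0 0)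
    (isFaceEdge_vertex_self h m hS₁) (isFaceEdge_vertex_self h n hS₂)

theorem covered_vertex_and_vertex_vertex {S₁ S₂ : BoundarySegment} (h : Frame i j k)
    (m : Fin 3)
    (hS₁ : S₁.carrier ∩ T.carrier = segment ℝ (T.vertex m) (T.vertex m))
    (hS₂ : S₂.carrier ∩ T.carrier = segment ℝ (T.vertex i) (T.vertex j)) :
    Covered T [S₁, S₂] :=
  covered_pair_of_tiles
    ⟨(2, 3), [(A, B, C)]⟩
    h (count_vertex hS₁) (count_vertex_vertex h.ij hS₂)
    (h.tiles_triangle T 0 0 0 0 0)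
    (isFaceEdge_vertex_self h m hS₁) ⟨A, B, by decide, hS₂⟩

theorem covered_vertex_and_vertex_side {S₁ S₂ : BoundarySegment} (h : Frame i j k)
    (m : Fin 3) (hq : T.OnSide i q)
    (hS₁ : S₁.carrier ∩ T.carrier = segment ℝ (T.vertex m) (T.vertex m))
    (hS₂ : S₂.carrier ∩ T.carrier = segment ℝ (T.vertex i) q) :
    Covered T [S₁, S₂] :=
  covered_pair_of_tiles
    ⟨(2, 3), [(A, B, Q1), (A, Q1, C)]⟩
    h (count_vertex hS₁) (count_vertex_side hq hS₂)
    (h.tiles_triangle T 0 q 0 0 0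
      |>.split_edge B C A Q1 (h.swap.mem_openSegment_of_onSide hq))
    (isFaceEdge_vertex_self h m hS₁) ⟨A, Q1, by decide, hS₂⟩
    (hq₁ := .inl (crossing_right (by simp) hS₂ hq (T.coord_vertex_pos i)))

theorem covered_vertex_and_side_side {S₁ S₂ : BoundarySegment} (h : Frame i j k)
    (m : Fin 3) (hq : T.OnSide j q) (hr : T.OnSide k r)
    (hS₁ : S₁.carrier ∩ T.carrier = segment ℝ (T.vertex m) (T.vertex m))
    (hS₂ : S₂.carrier ∩ T.carrier = segment ℝ q r) :
    Covered T [S₁, S₂] :=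
  covered_pair_of_tiles
    ⟨(2, 2), [(A, Q2, Q1), (Q2, B, Q1), (Q1, B, C)]⟩
    h (count_vertex hS₁) (count_side_side h.jk hq hr hS₂)
    (h.tiles_triangle T 0 q r 0 0
      |>.split_edge A C B Q1 (h.mem_openSegment_of_onSide hq)
      |>.split_edge A B Q1 Q2 (h.rotate.rotate.swap.mem_openSegment_of_onSide hr))
    (isFaceEdge_vertex_self h m hS₁) ⟨Q1, Q2, by decide, hS₂⟩
    (hq₁ := .inl (crossing_left (by simp) hS₂ hq (hr.2 j h.jk)))
    (hq₂ := .inl (crossing_right (by simp) hS₂ hr (hq.2 k h.jk.symm)))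

/-- Two disjoint traces starting on the side `A C` which cut off the corners `A` and `C`. -/
theorem covered_two_corners {S₁ S₂ : BoundarySegment} (h : Frame i j k)
    (hq : T.OnSide j q) (hq' : T.OnSide k q') (hr : T.OnSide j r) (hr' : T.OnSide i r')
    (hrq : T.coord i r < T.coord i q)
    (hS₁ : S₁.carrier ∩ T.carrier = segment ℝ q q')
    (hS₂ : S₂.carrier ∩ T.carrier = segment ℝ r r') :
    Covered T [S₁, S₂] :=
  covered_pair_of_tiles
    ⟨(2, 2), [(Q1, Q2, A), (Q1, Q4, Q2), (Q1, Q3, Q4), (Q1, B, Q3), (Q4, Q3, C)]⟩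
    h (count_side_side h.jk hq hq' hS₁) (count_side_side h.ij.symm hr hr' hS₂)
    (h.tiles_medial 0 q' q r' r Q1 Q3 Q4 hq' hr' hr
      |>.split_edge Q4 A Q1 Q2 (h.reverse.mem_openSegment_vertex hr hq hrq))
    ⟨Q2, Q1, by decide, hS₁⟩ ⟨Q4, Q3, by decide, hS₂⟩
    (hq₁ := .inl (crossing_right (by simp) hS₁ hq' (hq.2 k h.jk.symm)))
    (hq₂ := .inl (crossing_left (by simp) hS₁ hq (hq'.2 j h.jk)))
    (hq₃ := .inl (crossing_right (by simp) hS₂ hr' (hr.2 i h.ij)))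
    (hq₄ := .inl (crossing_left (by simp) hS₂ hr (hr'.2 j h.ij.symm)))

/-- Two disjoint traces starting on the side `A C` which both cut off the corner `C`. -/
theorem covered_same_corner {S₁ S₂ : BoundarySegment} (h : Frame i j k)
    (hq : T.OnSide j q) (hq' : T.OnSide i q') (hr : T.OnSide j r) (hr' : T.OnSide i r')
    (hqr : T.coord k q < T.coord k r) (hqr' : T.coord k q' < T.coord k r')
    (hS₁ : S₁.carrier ∩ T.carrier = segment ℝ q q')
    (hS₂ : S₂.carrier ∩ T.carrier = segment ℝ r r') :
    Covered T [S₁, S₂] :=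
  covered_pair_of_tiles
    ⟨(2, 2), [(A, B, Q2), (Q2, B, Q4), (Q1, Q2, Q4), (Q1, Q4, Q3), (Q1, Q3, C)]⟩
    h (count_side_side h.ij.symm hq hq' hS₁) (count_side_side h.ij.symm hr hr' hS₂)
    (h.tiles_triangle T 0 r q r' q'
      |>.split_edge A C B Q2 (h.mem_openSegment_of_onSide hq)
      |>.split_edge B C Q2 Q4 (h.swap.mem_openSegment_of_onSide hq')
      |>.split_edge Q2 C Q4 Q1 (h.mem_openSegment_vertex hq hr hqr)
      |>.split_edge Q4 C Q1 Q3 (h.swap.mem_openSegment_vertex hq' hr' hqr'))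
    ⟨Q2, Q4, by decide, hS₁⟩ ⟨Q1, Q3, by decide, hS₂⟩
    (hq₁ := .inl (crossing_left (by simp) hS₂ hr (hr'.2 j h.ij.symm)))
    (hq₂ := .inl (crossing_left (by simp) hS₁ hq (hq'.2 j h.ij.symm)))
    (hq₃ := .inl (crossing_right (by simp) hS₂ hr' (hr.2 i h.ij)))
    (hq₄ := .inl (crossing_right (by simp) hS₁ hq' (hq.2 i h.ij)))

/-- Two disjoint traces starting on the side `A C`, one ending at `B`, the other one cutting off
the corner `C`. -/
theorem covered_median_and_corner {S₁ S₂ : BoundarySegment} (h : Frame i j k)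
    (hq : T.OnSide j q) (hr : T.OnSide j r) (hr' : T.OnSide i r')
    (hqr : T.coord k q < T.coord k r)
    (hS₁ : S₁.carrier ∩ T.carrier = segment ℝ q (T.vertex j))
    (hS₂ : S₂.carrier ∩ T.carrier = segment ℝ r r') :
    Covered T [S₁, S₂] :=
  covered_pair_of_tiles
    ⟨(2, 3), [(A, B, Q1), (Q1, B, Q3), (Q1, Q3, Q2), (Q2, Q3, C)]⟩
    h (count_vertex_side hq (hS₁.trans (segment_symm ℝ _ _)))
    (count_side_side h.ij.symm hr hr' hS₂)
    (h.tiles_triangle T 0 q r r' 0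
      |>.split_edge A C B Q1 (h.mem_openSegment_of_onSide hq)
      |>.split_edge B C Q1 Q3 (h.swap.mem_openSegment_of_onSide hr')
      |>.split_edge Q1 C Q3 Q2 (h.mem_openSegment_vertex hq hr hqr))
    ⟨Q1, B, by decide, hS₁⟩ ⟨Q2, Q3, by decide, hS₂⟩
    (hq₁ := .inl (crossing_left (by simp) hS₁ hq (T.coord_vertex_pos j)))
    (hq₂ := .inl (crossing_left (by simp) hS₂ hr (hr'.2 j h.ij.symm)))
    (hq₃ := .inl (crossing_right (by simp) hS₂ hr' (hr.2 i h.ij)))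

end

/-! ### Metric consequences of the protocol -/

section Metric

variable {T : BaseTriangle} {i j k : Fin 3} {p v w x y : Plane}

theorem inner_sub_nonpos_of_angle (h : Real.pi / 2 ≤ EuclideanGeometry.angle v p w) :
    inner ℝ (v - p) (w - p) ≤ 0 := by
  rw [EuclideanGeometry.angle] at h
  have hc := Real.cos_nonpos_of_pi_div_two_le_of_le h
    ((InnerProductGeometry.angle_le_pi _ _).trans (by linarith [Real.pi_pos]))
  rw [← vsub_eq_sub, ← vsub_eq_sub, ← InnerProductGeometry.cos_angle_mul_norm_mul_norm]
  exact mul_nonpos_of_nonpos_of_nonneg hc (by positivity)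

theorem inner_sub_nonpos_of_mem (h : inner ℝ (v - p) (w - p) ≤ 0) (hx : x ∈ segment ℝ p v)
    (hy : y ∈ segment ℝ p w) : inner ℝ (x - p) (y - p) ≤ 0 := by
  rw [segment_eq_image_lineMap] at hx hy
  obtain ⟨s, hs, rfl⟩ := hx
  obtain ⟨t, ht, rfl⟩ := hy
  simp only [AffineMap.lineMap_apply, vsub_eq_sub, vadd_eq_add, add_sub_cancel_right,
    inner_smul_left, inner_smul_right, RCLike.conj_to_real]
  exact mul_nonpos_of_nonneg_of_nonpos ht.1 (mul_nonpos_of_nonneg_of_nonpos hs.1 h)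

/-- The side opposite to a right or obtuse angle is the longest one. -/
theorem dist_le_dist_of_inner_nonpos (h : inner ℝ (x - p) (y - p) ≤ 0) : dist x p ≤ dist x y := by
  rw [dist_eq_norm, dist_eq_norm]
  refine le_of_sq_le_sq ?_ (norm_nonneg _)
  have := norm_sub_sq_real (x - p) (y - p)
  rw [sub_sub_sub_cancel_right] at this
  nlinarith [sq_nonneg ‖y - p‖]

/-- Segments preceding and following a segment are as far apart as the length of that segment. -/
theorem dist_le_dist_of_inner_nonpos_of_inner_nonpos (hx : inner ℝ (x - p) (v - p) ≤ 0)
    (hy : inner ℝ (p - v) (y - v) ≤ 0) : dist p v ≤ dist x y := by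
  rw [dist_eq_norm', dist_eq_norm']
  have h1 : inner ℝ (y - x) (v - p) = inner ℝ (v - p) (v - p) - inner ℝ (x - p) (v - p) -
      inner ℝ (p - v) (y - v) := by
    have e1 : y - x = (v - p) - (x - p) + (y - v) := by abel
    have e2 : inner ℝ (p - v) (y - v) = - inner ℝ (y - v) (v - p) := by
      rw [real_inner_comm, ← inner_neg_right, neg_sub]
    rw [e1, inner_add_left, inner_sub_left, e2]; ring
  have h2 : ‖v - p‖ * ‖v - p‖ ≤ ‖y - x‖ * ‖v - p‖ := by
    rw [← real_inner_self_eq_norm_mul_norm]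
    refine le_trans ?_ (real_inner_le_norm _ _)
    linarith
  rcases (norm_nonneg (v - p)).eq_or_lt with h0 | h0
  · rw [← h0]; exact norm_nonneg _
  · exact le_of_mul_le_mul_right h2 h0

theorem BaseTriangle.dist_le (hx : x ∈ T.carrier) (hy : y ∈ T.carrier) :
    dist x y ≤ T.edgeLength := by
  obtain ⟨_, ⟨i, rfl⟩, _, ⟨j, rfl⟩, h⟩ := convexHull_exists_dist_ge2 hx hy
  refine h.trans ?_
  rcases eq_or_ne i j with rfl | hij
  · rw [dist_self]; exact T.edgeLength_pos.le
  · exact (T.equilateral i j hij).le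

theorem Frame.inner_edges (h : Frame i j k) :
    inner ℝ (T.vertex j - T.vertex i) (T.vertex k - T.vertex i) = T.edgeLength ^ 2 / 2 := by
  have h1 := T.equilateral j i h.ij.symm
  have h2 := T.equilateral k i h.ik.symm
  have h3 := T.equilateral j k h.jk
  rw [dist_eq_norm] at h1 h2 h3
  have := norm_sub_sq_real (T.vertex j - T.vertex i) (T.vertex k - T.vertex i)
  rw [sub_sub_sub_cancel_right, h1, h2, h3] at this
  linarith

/-- From a point beyond two sides (or at a vertex) the triangle is seen at an acute angle. -/
theorem Frame.inner_pos (h : Frame i j k) (hj : T.coord j p ≤ 0) (hk : T.coord k p ≤ 0)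
    (hx : x ∈ T.carrier) (hy : y ∈ T.carrier) (hxp : x ≠ p) (hyp : y ≠ p) :
    0 < inner ℝ (x - p) (y - p) := by
  have key : ∀ z : Plane, z - p = (T.coord j z - T.coord j p) • (T.vertex j - T.vertex i) +
      (T.coord k z - T.coord k p) • (T.vertex k - T.vertex i) := fun z => by
    have hz := h.sum_coord T z
    have hp := h.sum_coord T p
    have e : ∀ z, T.vertex i + T.coord j z • (T.vertex j - T.vertex i) +
        T.coord k z • (T.vertex k - T.vertex i) = z := fun z => by
      conv_rhs => rw [← h.combo_eq T z]
      rw [show T.coord i z = 1 - T.coord j z - T.coord k z by linarith [h.sum_coord T z]]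
      module
    conv_lhs => rw [← e z, ← e p]
    module
  have hpos : ∀ z ∈ T.carrier, z ≠ p → 0 ≤ T.coord j z - T.coord j p ∧
      0 ≤ T.coord k z - T.coord k p ∧
      0 < (T.coord j z - T.coord j p) + (T.coord k z - T.coord k p) := fun z hz hne => by
    obtain ⟨h1, h2, h3⟩ := (h.mem_carrier T).1 hz
    refine ⟨by linarith, by linarith, ?_⟩
    by_contra hle
    refine hne (h.rotate.ext T ?_ ?_) <;> linarith
  obtain ⟨a1, a2, a3⟩ := hpos x hx hxp
  obtain ⟨b1, b2, b3⟩ := hpos y hy hyp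
  have e1 : inner ℝ (T.vertex j - T.vertex i) (T.vertex j - T.vertex i) = T.edgeLength ^ 2 := by
    rw [real_inner_self_eq_norm_sq, ← dist_eq_norm, T.equilateral j i h.ij.symm]
  have e2 : inner ℝ (T.vertex k - T.vertex i) (T.vertex k - T.vertex i) = T.edgeLength ^ 2 := by
    rw [real_inner_self_eq_norm_sq, ← dist_eq_norm, T.equilateral k i h.ik.symm]
  have e3 := h.inner_edges (T := T)
  have e4 : inner ℝ (T.vertex k - T.vertex i) (T.vertex j - T.vertex i) = T.edgeLength ^ 2 / 2 := by
    rw [real_inner_comm, e3]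
  rw [key x, key y]
  simp only [inner_add_left, inner_add_right, inner_smul_left, inner_smul_right,
    RCLike.conj_to_real, e1, e2, e3, e4]
  have he : 0 < T.edgeLength ^ 2 := pow_pos T.edgeLength_pos 2
  set a := T.coord j x - T.coord j p
  set b := T.coord k x - T.coord k p
  set c := T.coord j y - T.coord j p
  set d := T.coord k y - T.coord k p
  have : 0 < T.edgeLength ^ 2 / 2 * ((a + b) * (c + d) + a * c + b * d) := by positivity
  linarith

end Metric

/-! ### First and last points of a segment in the triangle -/

section FirstLast

variable {T : BaseTriangle} {u v x y : Plane}

theorem coord_lineMap (T : BaseTriangle) (l : Fin 3) (u v : Plane) (t : ℝ) :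
    T.coord l (AffineMap.lineMap u v t) = (1 - t) * T.coord l u + t * T.coord l v := by
  rw [AffineMap.apply_lineMap, AffineMap.lineMap_apply_ring]

/-- If the segment leaves the triangle for good at the parameter `t`, it crosses a side there. -/
theorem exists_exit {t : ℝ} (ht0 : 0 ≤ t) (ht : AffineMap.lineMap u v t ∈ T.carrier)
    (hmax : ∀ r, 0 ≤ r → r ≤ 1 → AffineMap.lineMap u v r ∈ T.carrier → r ≤ t)
    (ht1 : t < 1) : ∃ l, T.coord l (AffineMap.lineMap u v t) = 0 ∧ T.coord l v < 0 := by
  by_contra! hne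
  rw [T.mem_carrier] at ht
  have hev : ∀ᶠ r in nhdsWithin t (Set.Ioi t), ∀ l, 0 ≤ T.coord l (AffineMap.lineMap u v r) := by
    rw [Filter.eventually_all]
    intro l
    rcases (ht l).eq_or_lt with h0 | h0
    · have hv := hne l h0.symm
      filter_upwards [Ioo_mem_nhdsGT ht1] with r hr
      -- The point at `r` lies between the one at `t` and `v`.
      have h1 := ht l
      rw [coord_lineMap] at h1 ⊢
      have : 0 ≤ (1 - t) * ((1 - r) * T.coord l u + r * T.coord l v) := by
        have e : (1 - t) * ((1 - r) * T.coord l u + r * T.coord l v) =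
            (1 - r) * ((1 - t) * T.coord l u + t * T.coord l v) + (r - t) * T.coord l v := by ring
        rw [e]
        exact add_nonneg (mul_nonneg (by linarith [hr.2]) h1)
          (mul_nonneg (by linarith [hr.1]) hv)
      exact nonneg_of_mul_nonneg_right this (by linarith)
    · have hc : Continuous fun r : ℝ => T.coord l (AffineMap.lineMap u v r) := by
        simp only [coord_lineMap]; fun_prop
      exact ((hc.tendsto t).mono_left nhdsWithin_le_nhds).eventually (lt_mem_nhds h0) |>.mono
        fun r hr => le_of_lt hr
  obtain ⟨r, hr, hr'⟩ := (hev.and (Ioo_mem_nhdsGT ht1)).exists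
  exact absurd (hmax r (by linarith [hr'.1]) hr'.2.le (T.mem_carrier.2 hr)) (not_le.2 hr'.1)

/-- `x` and `y` are the first and the last point in the triangle of the segment from `u` to `v`. -/
structure IsTrace (T : BaseTriangle) (u v x y : Plane) : Prop where
  eq : segment ℝ u v ∩ T.carrier = segment ℝ x y
  param : ∃ s t : ℝ, 0 ≤ s ∧ s ≤ t ∧ t ≤ 1 ∧ x = AffineMap.lineMap u v s ∧
    y = AffineMap.lineMap u v t
  first_mem : u ∈ T.carrier → x = u
  first : u ∉ T.carrier → ∃ l, T.coord l x = 0 ∧ T.coord l u < 0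
  last : v ∉ T.carrier → ∃ l, T.coord l y = 0 ∧ T.coord l v < 0

theorem exists_isTrace (h : (segment ℝ u v ∩ T.carrier).Nonempty) : ∃ x y, IsTrace T u v x y := by
  set I : Set ℝ := Set.Icc 0 1 ∩ (AffineMap.lineMap u v : ℝ →ᵃ[ℝ] Plane) ⁻¹' T.carrier with hI
  have hcont : Continuous (AffineMap.lineMap u v : ℝ →ᵃ[ℝ] Plane) := AffineMap.lineMap_continuous
  have hIc : IsCompact I := isCompact_Icc.inter_right (T.isClosed_carrier.preimage hcont)
  have hIne : I.Nonempty := by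
    obtain ⟨z, hz, hzT⟩ := h
    rw [segment_eq_image_lineMap] at hz
    obtain ⟨r, hr, rfl⟩ := hz
    exact ⟨r, hr, hzT⟩
  obtain ⟨s, ⟨⟨hs0, hs1⟩, hsT⟩, hs⟩ := hIc.exists_isLeast hIne
  obtain ⟨t, ⟨⟨ht0, ht1⟩, htT⟩, ht⟩ := hIc.exists_isGreatest hIne
  have hst : s ≤ t := hs ⟨⟨ht0, ht1⟩, htT⟩
  refine ⟨AffineMap.lineMap u v s, AffineMap.lineMap u v t, ?_, ⟨s, t, hs0, hst, ht1, rfl, rfl⟩,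
    ?_, ?_, ?_⟩
  · apply Set.Subset.antisymm
    · rintro z ⟨hz, hzT⟩
      rw [segment_eq_image_lineMap] at hz
      obtain ⟨r, hr, rfl⟩ := hz
      have : r ∈ segment ℝ s t := by
        rw [segment_eq_Icc hst]
        exact ⟨hs ⟨hr, hzT⟩, ht ⟨hr, hzT⟩⟩
      rw [← image_segment ℝ (AffineMap.lineMap u v : ℝ →ᵃ[ℝ] Plane) s t]
      exact ⟨r, this, rfl⟩
    · refine Set.subset_inter ?_ (T.convex_carrier.segment_subset hsT htT)
      refine (convex_segment u v).segment_subset ?_ ?_ <;> rw [segment_eq_image_lineMap]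
      exacts [⟨s, ⟨hs0, hs1⟩, rfl⟩, ⟨t, ⟨ht0, ht1⟩, rfl⟩]
  · intro hu
    have : s ≤ 0 := hs ⟨⟨le_rfl, zero_le_one⟩, by simpa using hu⟩
    rw [le_antisymm this hs0, AffineMap.lineMap_apply_zero]
  · intro hu
    have hs0' : 0 < s := by
      rcases hs0.eq_or_lt with h | h
      · subst h; exact absurd (by simpa using hsT) hu
      · exact h
    have := exists_exit (T := T) (u := v) (v := u) (t := 1 - s) (by linarith)
      (by rw [AffineMap.lineMap_apply_one_sub]; exact hsT)
      (fun r hr0 hr1 hr => by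
        have := hs (a := 1 - r) ⟨⟨by linarith, by linarith⟩, by
          rw [Set.mem_preimage, AffineMap.lineMap_apply_one_sub]; exact hr⟩
        linarith) (by linarith)
    rwa [AffineMap.lineMap_apply_one_sub] at this
  · intro hv
    refine exists_exit ht0 htT (fun r hr0 hr1 hr => ht ⟨⟨hr0, hr1⟩, hr⟩) ?_
    rcases ht1.eq_or_lt with h | h
    · subst h; exact absurd (by simpa using htT) hv
    · exact h

variable (h : IsTrace T u v x y)
include h

theorem IsTrace.left_mem : x ∈ segment ℝ u v ∩ T.carrier := h.eq ▸ left_mem_segment ℝ x y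

theorem IsTrace.right_mem : y ∈ segment ℝ u v ∩ T.carrier := h.eq ▸ right_mem_segment ℝ x y

theorem IsTrace.coord_right_pos {l : Fin 3} (hx : T.coord l x = 0) (hu : T.coord l u < 0) :
    x = y ∨ 0 < T.coord l y := by
  obtain ⟨s, t, hs, hst, ht, rfl, rfl⟩ := h.param
  rcases hst.eq_or_lt with rfl | hlt
  · exact Or.inl rfl
  · right
    rw [coord_lineMap] at hx ⊢
    have hs0 : 0 < s := by
      rcases hs.eq_or_lt with rfl | h
      · simp at hx; linarith
      · exact h
    have : 0 < s * ((1 - t) * T.coord l u + t * T.coord l v) := by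
      have e : s * ((1 - t) * T.coord l u + t * T.coord l v) =
        t * ((1 - s) * T.coord l u + s * T.coord l v) + (t - s) * -T.coord l u := by ring
      rw [e, hx, mul_zero, zero_add]
      exact mul_pos (by linarith) (by linarith)
    exact pos_of_mul_pos_right this hs0.le

theorem IsTrace.coord_left_pos {l : Fin 3} (hy : T.coord l y = 0) (hv : T.coord l v < 0) :
    x = y ∨ 0 < T.coord l x := by
  obtain ⟨s, t, hs, hst, ht, rfl, rfl⟩ := h.param
  rcases hst.eq_or_lt with rfl | hlt
  · exact Or.inl rfl
  · right
    rw [coord_lineMap] at hy ⊢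
    have ht1 : t < 1 := by
      rcases ht.eq_or_lt with rfl | h
      · simp at hy; linarith
      · exact h
    have : 0 < (1 - t) * ((1 - s) * T.coord l u + s * T.coord l v) := by
      have e : (1 - t) * ((1 - s) * T.coord l u + s * T.coord l v) =
        (1 - s) * ((1 - t) * T.coord l u + t * T.coord l v) + (t - s) * -T.coord l v := by ring
      rw [e, hy, mul_zero, zero_add]
      exact mul_pos (by linarith) (by linarith)
    exact pos_of_mul_pos_right this (by linarith)

/-- A segment does not enter and leave the triangle through the same side line. -/
theorem IsTrace.index_ne {l m : Fin 3} (hx : T.coord l x = 0) (hu : T.coord l u < 0)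
    (hy : T.coord m y = 0) (hv : T.coord m v < 0) : l ≠ m := by
  rintro rfl
  rcases h.coord_right_pos hx hu with rfl | hpos
  · obtain ⟨s, t, hs, hst, ht, hx', -⟩ := h.param
    rw [hx', coord_lineMap] at hx
    rcases hs.eq_or_lt with rfl | hs0
    · linarith
    · have h1 := mul_neg_of_pos_of_neg hs0 hv
      have h2 := mul_nonpos_of_nonneg_of_nonpos (show 0 ≤ 1 - s by linarith) hu.le
      linarith
  · exact hpos.ne' hy

/-- The first point of the trace divides the segment from the starting point to the last point. -/
theorem IsTrace.exists_ratio : ∃ r : ℝ, 0 ≤ r ∧ r ≤ 1 ∧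
    ∀ l, T.coord l x = (1 - r) * T.coord l u + r * T.coord l y := by
  obtain ⟨s, t, hs, hst, ht, rfl, rfl⟩ := h.param
  rcases (hs.trans hst).eq_or_lt with rfl | ht0
  · obtain rfl : s = 0 := le_antisymm hst hs
    exact ⟨1, by simp⟩
  · refine ⟨s / t, by positivity, (div_le_one ht0).2 hst, fun l => ?_⟩
    rw [coord_lineMap, coord_lineMap]
    field_simp
    ring

end FirstLast

/-! ### Strata of the ends of a trace -/

section Strata

variable {T : BaseTriangle} {i j k l : Fin 3} {p q x y : Plane} {S S₁ S₂ : BoundarySegment}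

theorem onSide_or_vertex (hp : p ∈ T.carrier) (hl : T.coord l p = 0) :
    T.OnSide l p ∨ ∃ m, m ≠ l ∧ p = T.vertex m := by
  obtain ⟨j, k, h⟩ := Frame.exists_of_index l
  have hp := T.mem_carrier.1 hp
  rcases (hp j).eq_or_lt with hj | hj
  · exact Or.inr ⟨k, h.ik.symm, h.rotate.rotate.eq_vertex T hl hj.symm⟩
  rcases (hp k).eq_or_lt with hk | hk
  · exact Or.inr ⟨j, h.ij.symm, h.rotate.eq_vertex T hk.symm hl⟩
  exact Or.inl (h.swap.onSide hl hj hk)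

theorem inside_or_onSide_or_vertex (hp : p ∈ T.carrier) :
    T.Inside p ∨ (∃ l, T.OnSide l p) ∨ ∃ m, p = T.vertex m := by
  by_cases h : ∃ l, T.coord l p = 0
  · obtain ⟨l, hl⟩ := h
    rcases onSide_or_vertex hp hl with h | ⟨m, -, h⟩
    · exact Or.inr (Or.inl ⟨l, h⟩)
    · exact Or.inr (Or.inr ⟨m, h⟩)
  · push Not at h
    exact Or.inl fun l => lt_of_le_of_ne (T.mem_carrier.1 hp l) (h l).symm

/-- A segment starting at the point `p` of the triangle leaves it at `y`. -/
structure Exits (T : BaseTriangle) (S : BoundarySegment) (p y : Plane) : Prop where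
  eq : S.carrier ∩ T.carrier = segment ℝ p y
  exit : ∃ l, T.coord l y = 0 ∧ (p = y ∨ 0 < T.coord l p)

theorem Exits.mem (h : Exits T S p y) : y ∈ T.carrier := (trace_right_mem h.eq).2

theorem Exits.exists_onSide_or_vertex (h : Exits T S p y) :
    (∃ l, T.OnSide l y) ∨ ∃ m, y = T.vertex m := by
  obtain ⟨l, hl, -⟩ := h.exit
  exact (onSide_or_vertex h.mem hl).imp (fun h => ⟨l, h⟩) fun ⟨m, _, h⟩ => ⟨m, h⟩

theorem Exits.of_onSide (h : Exits T S p y) (hp : T.OnSide j p) :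
    y = p ∨ (∃ m, m ≠ j ∧ y = T.vertex m) ∨ y = T.vertex j ∨ ∃ l, l ≠ j ∧ T.OnSide l y := by
  obtain ⟨l, hl, rfl | hpl⟩ := h.exit
  · exact Or.inl rfl
  · have hlj : l ≠ j := fun e => by rw [e, hp.1] at hpl; exact lt_irrefl _ hpl
    rcases onSide_or_vertex h.mem hl with hy | ⟨m, -, rfl⟩
    · exact Or.inr (Or.inr (Or.inr ⟨l, hlj, hy⟩))
    · by_cases hm : m = j
      · exact Or.inr (Or.inr (Or.inl (by rw [hm])))
      · exact Or.inr (Or.inl ⟨m, hm, rfl⟩)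

theorem Exits.of_vertex (h : Exits T S (T.vertex i) y) :
    y = T.vertex i ∨ T.OnSide i y ∨ ∃ m, m ≠ i ∧ y = T.vertex m := by
  obtain ⟨l, hl, e | hpl⟩ := h.exit
  · exact Or.inl e.symm
  · have hli : l = i := by
      by_contra hne
      rw [T.coord_vertex_ne hne] at hpl
      exact lt_irrefl _ hpl
    subst hli
    rcases onSide_or_vertex h.mem hl with hy | ⟨m, hm, rfl⟩
    · exact Or.inr (Or.inl hy)
    · exact Or.inr (Or.inr ⟨m, hm, rfl⟩)

/-! ### Configurations of one segment -/

/-- A segment with an endpoint in the triangle. -/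
theorem covered_of_exits (hP : p ∈ endPoints T [S]) (h : Exits T S p y) : Covered T [S] := by
  rcases inside_or_onSide_or_vertex hP.1 with hp | ⟨j, hp⟩ | ⟨i, rfl⟩
  · rcases h.exists_onSide_or_vertex with ⟨l, hy⟩ | ⟨m, rfl⟩
    · obtain ⟨j, k, hf⟩ := Frame.exists_of_index l
      exact covered_inside_side hf.swap hp hy hP h.eq
    · obtain ⟨j, k, hf⟩ := Frame.exists_of_index m
      exact covered_inside_vertex hf hp hP h.eq
  · rcases h.of_onSide hp with rfl | ⟨m, hm, rfl⟩ | rfl | ⟨l, hl, hy⟩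
    · obtain ⟨i, k, hf⟩ := Frame.exists_of_index j
      exact covered_side hf.swap hp hP h.eq
    · obtain ⟨k, hf⟩ := Frame.exists_third hm
      exact covered_side_vertex hf hp hP h.eq
    · obtain ⟨i, k, hf⟩ := Frame.exists_of_index j
      exact covered_vertex_side hf hp (h.eq.trans (segment_symm ℝ _ _))
    · obtain ⟨k, hf⟩ := Frame.exists_third hl.symm
      exact covered_side_side hf hp hy h.eq
  · rcases h.of_vertex with rfl | hy | ⟨m, hm, rfl⟩
    · obtain ⟨j, k, hf⟩ := Frame.exists_of_index i
      exact covered_vertex hf h.eq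
    · obtain ⟨j, k, hf⟩ := Frame.exists_of_index i
      exact covered_vertex_side hf hy h.eq
    · obtain ⟨k, hf⟩ := Frame.exists_third hm.symm
      exact covered_vertex_vertex hf h.eq

/-- A segment with no endpoint in the triangle. -/
theorem covered_of_crossing {u v : Plane} (hS : S.carrier = segment ℝ u v)
    (h : IsTrace T u v x y) (hu : u ∉ T.carrier) (hv : v ∉ T.carrier) : Covered T [S] := by
  have heq : S.carrier ∩ T.carrier = segment ℝ x y := hS ▸ h.eq
  obtain ⟨l, hxl, hul⟩ := h.first hu
  obtain ⟨m, hym, hvm⟩ := h.last hv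
  have hlm := h.index_ne hxl hul hym hvm
  obtain ⟨n, hf⟩ := Frame.exists_third hlm
  by_cases hxy : x = y
  · subst hxy
    rw [hf.rotate.rotate.eq_vertex T hxl hym] at heq
    exact covered_vertex hf.rotate.rotate heq
  have hyl := (h.coord_right_pos hxl hul).resolve_left hxy
  have hxm := (h.coord_left_pos hym hvm).resolve_left hxy
  have hxT := T.mem_carrier.1 h.left_mem.2 n
  have hyT := T.mem_carrier.1 h.right_mem.2 n
  rcases hxT.eq_or_lt with hxn | hxn
  · obtain rfl := hf.rotate.eq_vertex T hxn.symm hxl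
    rcases hyT.eq_or_lt with hyn | hyn
    · obtain rfl := hf.eq_vertex T hym hyn.symm
      exact covered_vertex_vertex hf.swap heq
    · exact covered_vertex_side hf.swap (hf.onSide hym hyl hyn) heq
  · have hx := hf.swap.onSide hxl hxm hxn
    rcases hyT.eq_or_lt with hyn | hyn
    · obtain rfl := hf.eq_vertex T hym hyn.symm
      exact covered_vertex_side hf hx (heq.trans (segment_symm ℝ _ _))
    · exact covered_side_side hf hx (hf.onSide hym hyl hyn) heq

/-! ### Two segments meeting in the triangle -/

variable (hP : p ∈ endPoints T [S₁, S₂]) (h₁ : Exits T S₁ p x) (h₂ : Exits T S₂ p y)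
include hP h₁ h₂

theorem covered_pair_of_inside (hxy : x = y → x = p) (hp : T.Inside p) : Covered T [S₁, S₂] := by
  rcases h₁.exists_onSide_or_vertex with ⟨l, hx⟩ | ⟨m, rfl⟩ <;>
    rcases h₂.exists_onSide_or_vertex with ⟨l', hy⟩ | ⟨m', rfl⟩
  · by_cases hl : l = l'
    · subst hl
      obtain ⟨i, k, hf⟩ := Frame.exists_of_index l
      rcases lt_trichotomy (T.coord i x) (T.coord i y) with hlt | he | hgt
      · exact covered_inside_same_side hf.swap hp hx hy hlt hP h₁.eq h₂.eq
      · obtain rfl := hf.ext T (hx.1.trans hy.1.symm) he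
        exact absurd hx.1 (by rw [hxy rfl]; exact (hp l).ne')
      · exact (covered_inside_same_side hf.swap hp hy hx hgt (mem_endPoints_swap hP)
          h₂.eq h₁.eq).swap
    · obtain ⟨k, hf⟩ := Frame.exists_third (Ne.symm hl)
      exact covered_inside_side_side hf hp hx hy hP h₁.eq h₂.eq
  · obtain ⟨i, k, hf⟩ := Frame.exists_of_index l
    exact (covered_inside_vertex_side hf.swap m' hp hx (mem_endPoints_swap hP) h₂.eq h₁.eq).swap
  · obtain ⟨i, k, hf⟩ := Frame.exists_of_index l'
    exact covered_inside_vertex_side hf.swap m hp hy hP h₁.eq h₂.eq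
  · obtain ⟨j, k, hf⟩ := Frame.exists_of_index m
    exact covered_inside_vertex_vertex hf m m' hp hP h₁.eq h₂.eq

theorem covered_pair_of_side_stay (hp : T.OnSide j p) (hx : x = p) : Covered T [S₁, S₂] := by
  subst hx
  rcases h₂.of_onSide hp with rfl | ⟨m, hm, rfl⟩ | rfl | ⟨l, hl, hy⟩
  · obtain ⟨i, k, hf⟩ := Frame.exists_of_index j
    exact covered_side_stay_stay hf.swap hp hP h₁.eq h₂.eq
  · obtain ⟨k, hf⟩ := Frame.exists_third hm
    exact covered_side_stay_end hf hp hP h₁.eq h₂.eq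
  · obtain ⟨i, k, hf⟩ := Frame.exists_of_index j
    exact covered_side_stay_opposite hf.swap hp hP h₁.eq h₂.eq
  · obtain ⟨k, hf⟩ := Frame.exists_third hl
    exact covered_side_stay_side hf hp hy hP h₁.eq h₂.eq

theorem covered_pair_of_side_end {m : Fin 3} (hxy : x = y → x = p) (hp : T.OnSide j p)
    (hm : m ≠ j) (hx : x = T.vertex m) : Covered T [S₁, S₂] := by
  subst hx
  have hmp : T.vertex m ≠ p := fun e => by
    obtain ⟨n, hf⟩ := Frame.exists_third hm
    have := hp.2 n hf.jk.symm
    rw [← e, T.coord_vertex_ne hf.ik.symm] at this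
    exact lt_irrefl _ this
  rcases h₂.of_onSide hp with hy | ⟨m', hm', rfl⟩ | rfl | ⟨l, hl, hy⟩
  · exact (covered_pair_of_side_stay (mem_endPoints_swap hP) h₂ h₁ hp hy).swap
  · have hne : m ≠ m' := fun e => hmp (hxy (by rw [e]))
    exact covered_side_end_end ⟨hm, hm'.symm, hne⟩ hp hP h₁.eq h₂.eq
  · obtain ⟨k, hf⟩ := Frame.exists_third hm
    exact covered_side_end_opposite hf hp hP h₁.eq h₂.eq
  · obtain ⟨k, hf⟩ := Frame.exists_third hl
    exact covered_side_end_side hf hp m hm hy hP h₁.eq h₂.eq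

theorem covered_pair_of_side_opposite (hxy : x = y → x = p) (hp : T.OnSide j p)
    (hx : x = T.vertex j) : Covered T [S₁, S₂] := by
  subst hx
  have hjp : T.vertex j ≠ p := fun e => by
    have := hp.1
    rw [← e, T.coord_vertex_self] at this
    exact one_ne_zero this
  rcases h₂.of_onSide hp with hy | ⟨m, hm, hy⟩ | rfl | ⟨l, hl, hy⟩
  · exact (covered_pair_of_side_stay (mem_endPoints_swap hP) h₂ h₁ hp hy).swap
  · exact (covered_pair_of_side_end (mem_endPoints_swap hP) h₂ h₁
      (fun e => e.trans (hxy e.symm)) hp hm hy).swap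
  · exact absurd (hxy rfl) hjp
  · obtain ⟨k, hf⟩ := Frame.exists_third hl
    exact covered_side_opposite_side hf hp hy hP h₁.eq h₂.eq

theorem covered_pair_of_onSide (hxy : x = y → x = p) (hp : T.OnSide j p) :
    Covered T [S₁, S₂] := by
  have hyx : y = x → y = p := fun e => e.trans (hxy e.symm)
  have hP' := mem_endPoints_swap hP
  rcases h₁.of_onSide hp with hx | ⟨m, hm, hx⟩ | hx | ⟨l, hl, hx⟩
  · exact covered_pair_of_side_stay hP h₁ h₂ hp hx
  · exact covered_pair_of_side_end hP h₁ h₂ hxy hp hm hx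
  · exact covered_pair_of_side_opposite hP h₁ h₂ hxy hp hx
  rcases h₂.of_onSide hp with hy | ⟨m, hm, hy⟩ | hy | ⟨l', hl', hy⟩
  · exact (covered_pair_of_side_stay hP' h₂ h₁ hp hy).swap
  · exact (covered_pair_of_side_end hP' h₂ h₁ hyx hp hm hy).swap
  · exact (covered_pair_of_side_opposite hP' h₂ h₁ hyx hp hy).swap
  by_cases hll : l = l'
  · subst hll
    obtain ⟨k, hf⟩ := Frame.exists_third hl
    rcases lt_trichotomy (T.coord j x) (T.coord j y) with hlt | he | hgt
    · exact covered_side_same_side hf hp hx hy hlt hP h₁.eq h₂.eq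
    · obtain rfl := hf.ext T (hx.1.trans hy.1.symm) he
      have := hx.2 j hl.symm
      rw [hxy rfl, hp.1] at this
      exact absurd this (lt_irrefl _)
    · exact (covered_side_same_side hf hp hy hx hgt hP' h₂.eq h₁.eq).swap
  · exact covered_side_side_side ⟨hl', hl.symm, Ne.symm hll⟩ hp hx hy hP h₁.eq h₂.eq

omit hP in
theorem covered_pair_of_vertex_stay (hp : p = T.vertex i) (hx : x = p) : Covered T [S₁, S₂] := by
  subst hx hp
  obtain ⟨j, k, hf⟩ := Frame.exists_of_index i
  rcases h₂.of_vertex with rfl | hy | ⟨m, hm, rfl⟩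
  · exact covered_vertex_and_vertex hf i i h₁.eq h₂.eq
  · exact covered_vertex_and_vertex_side hf i hy h₁.eq h₂.eq
  · obtain ⟨n, hf⟩ := Frame.exists_third hm.symm
    exact covered_vertex_and_vertex_vertex hf i h₁.eq h₂.eq

/-- Two segments meeting in a point `p` of the triangle, not in the same direction and not both
running on into the triangle if `p` is a vertex. -/
theorem covered_pair_of_exits (hxy : x = y → x = p)
    (hv : ∀ m, p = T.vertex m → x = p ∨ y = p) : Covered T [S₁, S₂] := by
  rcases inside_or_onSide_or_vertex hP.1 with hp | ⟨j, hp⟩ | ⟨i, hp⟩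
  · exact covered_pair_of_inside hP h₁ h₂ hxy hp
  · exact covered_pair_of_onSide hP h₁ h₂ hxy hp
  · rcases hv i hp with h | h
    · exact covered_pair_of_vertex_stay h₁ h₂ hp h
    · exact (covered_pair_of_vertex_stay h₂ h₁ hp h).swap

end Strata

/-! ### Two segments meeting outside the triangle -/

section Outside

variable {T : BaseTriangle} {i j k : Fin 3} {p v x y x' y' : Plane} {S S₁ S₂ : BoundarySegment}

/-- The segment `S` comes from the point `p` and enters the triangle at `x`, in the interior of the
side opposite to the vertex `i`, on its way to the last point `y`. -/
structure Enters (T : BaseTriangle) (i : Fin 3) (S : BoundarySegment) (p x y : Plane) : Prop where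
  eq : S.carrier ∩ T.carrier = segment ℝ x y
  onSide : T.OnSide i x
  ratio : ∃ r : ℝ, 0 ≤ r ∧ r ≤ 1 ∧ ∀ l, T.coord l x = (1 - r) * T.coord l p + r * T.coord l y

/-- A segment coming from a point beyond the side opposite to `i` either touches the triangle at a
vertex, or enters through the interior of that side and leaves elsewhere. -/
theorem outside_cases (h : Frame i j k) (hS : S.carrier = segment ℝ p v) (hT : IsTrace T p v x y)
    (hi : T.coord i p < 0) (hj : 0 < T.coord j p) (hk : 0 < T.coord k p) (hv : v ∉ T.carrier) :
    (∃ m, S.carrier ∩ T.carrier = segment ℝ (T.vertex m) (T.vertex m)) ∨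
      Enters T i S p x y ∧ (y = T.vertex i ∨ T.OnSide j y ∨ T.OnSide k y) := by
  have heq : S.carrier ∩ T.carrier = segment ℝ x y := hS ▸ hT.eq
  have hp : p ∉ T.carrier := fun hp => absurd (T.mem_carrier.1 hp i) (not_le.2 hi)
  have hxi : T.coord i x = 0 := by
    obtain ⟨l, hl, hl'⟩ := hT.first hp
    rcases h.eq_or l with rfl | rfl | rfl
    exacts [hl, absurd hl' hj.not_gt, absurd hl' hk.not_gt]
  have hy := T.mem_carrier.1 hT.right_mem.2
  obtain ⟨m, hym, hvm⟩ := hT.last hv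
  have him := hT.index_ne hxi hi hym hvm
  by_cases hxy : x = y
  · subst hxy
    obtain ⟨n, hf⟩ := Frame.exists_third him
    rw [hf.rotate.rotate.eq_vertex T hxi hym] at heq
    exact Or.inl ⟨n, heq⟩
  · right
    obtain ⟨r, hr0, hr1, hr⟩ := hT.exists_ratio
    have hr1' : r < 1 := lt_of_le_of_ne hr1 fun e => hxy (h.ext T (by simp [hr, e]) (by simp [hr, e]))
    have hpos : ∀ l, 0 < T.coord l p → 0 < T.coord l x := fun l hl => by
      rw [hr]
      exact add_pos_of_pos_of_nonneg (mul_pos (by linarith) hl) (mul_nonneg hr0 (hy l))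
    have hyi := (hT.coord_right_pos hxi hi).resolve_left hxy
    refine ⟨⟨heq, h.swap.onSide hxi (hpos j hj) (hpos k hk), r, hr0, hr1, hr⟩, ?_⟩
    rcases onSide_or_vertex hT.right_mem.2 hym with hside | ⟨n, -, rfl⟩
    · rcases h.eq_or m with rfl | rfl | rfl
      exacts [absurd rfl him, Or.inr (Or.inl hside), Or.inr (Or.inr hside)]
    · left
      by_contra hne
      rw [T.coord_vertex_ne fun e => hne (by rw [e])] at hyi
      exact lt_irrefl _ hyi

/-- The entry point of a ray as a function of its exit point. -/
theorem Enters.coord_mul (h : Enters T i S p x y) (hy : T.coord k y = 0) :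
    T.coord k x * (T.coord i y - T.coord i p) = T.coord k p * T.coord i y := by
  obtain ⟨r, -, -, hr⟩ := h.ratio
  have hi := hr i
  have hk := hr k
  rw [h.onSide.1] at hi
  rw [hy] at hk
  linear_combination (T.coord i y - T.coord i p) * hk + T.coord k p * hi

/-- Rays from a point beyond the side opposite to `i` which leave through the closed side opposite
to `k` cross the two sides in the same order. -/
theorem Enters.coord_lt (h : Enters T i S₁ p x y) (h' : Enters T i S₂ p x' y')
    (hi : T.coord i p < 0) (hk : 0 < T.coord k p) (hy : T.coord k y = 0) (hy' : T.coord k y' = 0)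
    (hlt : T.coord i y < T.coord i y') : T.coord k x < T.coord k x' := by
  have e := h.coord_mul hy
  have e' := h'.coord_mul hy'
  have hy0 := T.mem_carrier.1 (trace_right_mem h.eq).2 i
  have a : 0 < T.coord i y - T.coord i p := by linarith
  have a' : 0 < T.coord i y' - T.coord i p := by linarith
  by_contra! hle
  have h1 : (T.coord k x' - T.coord k x) * ((T.coord i y - T.coord i p) *
      (T.coord i y' - T.coord i p)) = T.coord k p * -T.coord i p * (T.coord i y' - T.coord i y) := by
    linear_combination (T.coord i y - T.coord i p) * e' - (T.coord i y' - T.coord i p) * e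
  have h2 : 0 < T.coord k p * -T.coord i p * (T.coord i y' - T.coord i y) :=
    mul_pos (mul_pos hk (by linarith)) (by linarith)
  have h3 := mul_nonpos_of_nonpos_of_nonneg (show T.coord k x' - T.coord k x ≤ 0 by linarith)
    (mul_pos a a').le
  linarith

/-- A ray leaving through the open side opposite to `k` enters between the vertex `j` and the entry
point of the ray to the vertex `i`, whose coordinate `k` is `p_k / (1 - p_i)`. -/
theorem Enters.coord_mul_lt (h : Frame i j k) (he : Enters T i S p x y)
    (hi : T.coord i p < 0) (hk : 0 < T.coord k p) (hy : T.OnSide k y) :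
    T.coord k x * (1 - T.coord i p) < T.coord k p := by
  have e := he.coord_mul hy.1
  have hy0 := hy.2 i h.ik
  have hy1 : T.coord i y < 1 := by
    have := h.sum_coord T y
    have := hy.2 j h.jk
    linarith [hy.1]
  have a : 0 < T.coord i y - T.coord i p := by linarith
  have h1 : (T.coord k p - T.coord k x * (1 - T.coord i p)) * (T.coord i y - T.coord i p) =
      T.coord k p * -T.coord i p * (1 - T.coord i y) := by
    linear_combination -(1 - T.coord i p) * e
  have h2 : 0 < T.coord k p * -T.coord i p * (1 - T.coord i y) :=
    mul_pos (mul_pos hk (by linarith)) (by linarith)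
  rw [← h1] at h2
  linarith [pos_of_mul_pos_left h2 a.le]

/-- Two rays from outside, one leaving at the opposite vertex and one through a side. -/
theorem covered_outside_median_corner (h : Frame i j k) (h₁ : Enters T i S₁ p x y)
    (h₂ : Enters T i S₂ p x' y') (hi : T.coord i p < 0) (hk : 0 < T.coord k p)
    (hy : y = T.vertex i) (hy' : T.OnSide k y') : Covered T [S₁, S₂] := by
  subst hy
  have hlt : T.coord k x' < T.coord k x := by
    refine h₂.coord_lt h₁ hi hk hy'.1 (T.coord_vertex_ne h.ik.symm) ?_
    rw [T.coord_vertex_self]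
    have := h.sum_coord T y'
    have := hy'.2 j h.jk
    linarith [hy'.1]
  exact covered_median_and_corner h.rotate.rotate h₁.onSide h₂.onSide hy'
    ((h.swap.coord_lt_iff_of_onSide h₂.onSide h₁.onSide).1 hlt) h₁.eq h₂.eq

/-- Two rays from outside leaving through the same side do not cross, so they are nested. -/
theorem covered_outside_same_corner (h : Frame i j k) (h₁ : Enters T i S₁ p x y)
    (h₂ : Enters T i S₂ p x' y') (hi : T.coord i p < 0) (hk : 0 < T.coord k p)
    (hy : T.OnSide k y) (hy' : T.OnSide k y') (hne : y ≠ y') : Covered T [S₁, S₂] := by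
  have key : ∀ {S₁ S₂ : BoundarySegment} {x y x' y' : Plane}, Enters T i S₁ p x y →
      Enters T i S₂ p x' y' → T.OnSide k y → T.OnSide k y' → T.coord i y < T.coord i y' →
      Covered T [S₂, S₁] := fun h₁ h₂ hy hy' hlt =>
    covered_same_corner h.rotate.rotate h₂.onSide hy' h₁.onSide hy
      ((h.swap.coord_lt_iff_of_onSide h₁.onSide h₂.onSide).1 (h₁.coord_lt h₂ hi hk hy.1 hy'.1 hlt))
      ((h.swap_right.coord_lt_iff_of_onSide hy' hy).2 hlt) h₂.eq h₁.eq
  rcases lt_trichotomy (T.coord i y) (T.coord i y') with hlt | he | hgt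
  · exact (key h₁ h₂ hy hy' hlt).swap
  · exact absurd (h.rotate.rotate.ext T (hy.1.trans hy'.1.symm) he) hne
  · exact key h₂ h₁ hy' hy hgt

/-- Two rays from outside leaving through different sides are separated by the line from the
source to the vertex `i`. -/
theorem covered_outside_two_corners (h : Frame i j k) (h₁ : Enters T i S₁ p x y)
    (h₂ : Enters T i S₂ p x' y') (hi : T.coord i p < 0) (hj : 0 < T.coord j p)
    (hk : 0 < T.coord k p) (hy : T.OnSide j y) (hy' : T.OnSide k y') : Covered T [S₁, S₂] := by
  have e := h₁.coord_mul_lt h.swap_right hi hj hy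
  have e' := h₂.coord_mul_lt h hi hk hy'
  have hs := h.sum_coord T p
  have hx := h.sum_coord T x
  rw [h₁.onSide.1, zero_add] at hx
  have hlt : T.coord k x' < T.coord k x := by
    have : (T.coord j x + T.coord k x') * (1 - T.coord i p) < 1 * (1 - T.coord i p) := by linarith
    linarith [lt_of_mul_lt_mul_right this (by linarith)]
  exact covered_two_corners h.rotate.rotate h₁.onSide hy h₂.onSide hy' hlt
    h₁.eq h₂.eq

/-- Two disjoint traces of segments coming from a point beyond the side opposite to `i`. -/
theorem covered_of_outside {w : Plane} (h : Frame i j k) (hS₁ : S₁.carrier = segment ℝ p v)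
    (hS₂ : S₂.carrier = segment ℝ p w) (h₁ : IsTrace T p v x y) (h₂ : IsTrace T p w x' y')
    (hi : T.coord i p < 0) (hj : 0 < T.coord j p) (hk : 0 < T.coord k p) (hv : v ∉ T.carrier)
    (hw : w ∉ T.carrier) (hne : y ≠ y') : Covered T [S₁, S₂] := by
  have key : ∀ {S₁ S₂ : BoundarySegment} {x' y' : Plane} {m : Fin 3},
      S₁.carrier ∩ T.carrier = segment ℝ (T.vertex m) (T.vertex m) →
      Enters T i S₂ p x' y' ∧ (y' = T.vertex i ∨ T.OnSide j y' ∨ T.OnSide k y') →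
      Covered T [S₁, S₂] := by
    rintro S₁ S₂ x' y' m hm ⟨e, rfl | hy | hy⟩
    · exact covered_vertex_and_vertex_side h m e.onSide hm (e.eq.trans (segment_symm ℝ _ _))
    · exact covered_vertex_and_side_side h.rotate.rotate m e.onSide hy hm e.eq
    · exact covered_vertex_and_side_side h.swap m e.onSide hy hm e.eq
  rcases outside_cases h hS₁ h₁ hi hj hk hv with ⟨m, hm⟩ | H₁ <;>
    rcases outside_cases h hS₂ h₂ hi hj hk hw with ⟨m', hm'⟩ | H₂
  · exact covered_vertex_and_vertex h m m' hm hm'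
  · exact key hm H₂
  · exact (key hm' H₁).swap
  obtain ⟨e₁, hy⟩ := H₁
  obtain ⟨e₂, hy'⟩ := H₂
  rcases hy with hy | hy | hy <;> rcases hy' with hy' | hy' | hy'
  · exact absurd (hy.trans hy'.symm) hne
  · exact covered_outside_median_corner h.swap_right e₁ e₂ hi hj hy hy'
  · exact covered_outside_median_corner h e₁ e₂ hi hk hy hy'
  · exact (covered_outside_median_corner h.swap_right e₂ e₁ hi hj hy' hy).swap
  · exact covered_outside_same_corner h.swap_right e₁ e₂ hi hj hy hy' hne
  · exact covered_outside_two_corners h e₁ e₂ hi hj hk hy hy'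
  · exact (covered_outside_median_corner h e₂ e₁ hi hk hy' hy).swap
  · exact (covered_outside_two_corners h e₂ e₁ hi hj hk hy' hy).swap
  · exact covered_outside_same_corner h e₁ e₂ hi hk hy hy' hne

end Outside

/-! ### Configurations under the protocol -/

section Protocol

variable {T : BaseTriangle} {p v w : Plane}

theorem IsTrace.exits {S : BoundarySegment} {x y : Plane} (hS : S.carrier = segment ℝ p v)
    (h : IsTrace T p v x y) (hp : p ∈ T.carrier) (hv : v ∉ T.carrier) : Exits T S p y := by
  obtain rfl := h.first_mem hp
  obtain ⟨l, hl, hl'⟩ := h.last hv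
  exact ⟨hS ▸ h.eq, l, hl, h.coord_left_pos hl hl'⟩

theorem not_mem_of_edgeLength_lt_dist (h : T.edgeLength < dist p v) (hp : p ∈ T.carrier) :
    v ∉ T.carrier := fun hv => absurd (T.dist_le hp hv) (not_le.2 h)

theorem covered_of_single {S : BoundarySegment} (hS : T.Meets S)
    (hlen : T.edgeLength < dist S.source S.target) : Covered T [S] := by
  by_cases h1 : S.source ∈ T.carrier
  · obtain ⟨x, y, h⟩ := exists_isTrace hS
    exact covered_of_exits ⟨h1, S, by simp, Or.inl rfl⟩
      (h.exits rfl h1 (not_mem_of_edgeLength_lt_dist hlen h1))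
  by_cases h2 : S.target ∈ T.carrier
  · have e : S.carrier = segment ℝ S.target S.source := segment_symm ℝ _ _
    rw [BaseTriangle.Meets, e] at hS
    obtain ⟨x, y, h⟩ := exists_isTrace hS
    exact covered_of_exits ⟨h2, S, by simp, Or.inr rfl⟩ (h.exits e h2 h1)
  · obtain ⟨x, y, h⟩ := exists_isTrace hS
    exact covered_of_crossing rfl h h1 h2

/-- A point outside the triangle from which the triangle is seen at a right or obtuse angle lies
beyond exactly one side, strictly between the lines of the other two. -/
theorem exists_frame_of_outside {x y : Plane} (hp : p ∉ T.carrier) (hx : x ∈ T.carrier)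
    (hy : y ∈ T.carrier) (hxy : inner ℝ (x - p) (y - p) ≤ 0) :
    ∃ i j k, Frame i j k ∧ T.coord i p < 0 ∧ 0 < T.coord j p ∧ 0 < T.coord k p := by
  have hne : ∀ z ∈ T.carrier, z ≠ p := fun z hz e => hp (e ▸ hz)
  rw [T.mem_carrier] at hp
  push Not at hp
  obtain ⟨i, hi⟩ := hp
  have key : ∀ l, l ≠ i → 0 < T.coord l p := fun l hl => by
    by_contra! hle
    obtain ⟨m, h⟩ := Frame.exists_third hl
    exact absurd (h.rotate.rotate.inner_pos hle hi.le hx hy (hne x hx) (hne y hy)) (not_lt.2 hxy)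
  obtain ⟨j, k, h⟩ := Frame.exists_of_index i
  exact ⟨i, j, k, h, hi, key j h.ij.symm, key k h.ik.symm⟩

/-- Two consecutive segments. If their common point `p` is outside the triangle, then no endpoint
lies in it: the distance of an endpoint in the triangle to a point of the other trace would exceed
the length of the segment. -/
theorem covered_of_pair (hS₁ : T.Meets ⟨v, p⟩) (hS₂ : T.Meets ⟨p, w⟩)
    (hang : inner ℝ (v - p) (w - p) ≤ 0) (h₁ : T.edgeLength < dist v p)
    (h₂ : T.edgeLength < dist p w) : Covered T [⟨v, p⟩, ⟨p, w⟩] := by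
  have e : (⟨v, p⟩ : BoundarySegment).carrier = segment ℝ p v := segment_symm ℝ _ _
  rw [BaseTriangle.Meets, e] at hS₁
  obtain ⟨x, y, t₁⟩ := exists_isTrace hS₁
  obtain ⟨x', y', t₂⟩ := exists_isTrace hS₂
  have hin : ∀ a ∈ segment ℝ p v, ∀ b ∈ segment ℝ p w, inner ℝ (a - p) (b - p) ≤ 0 :=
    fun a ha b hb => inner_sub_nonpos_of_mem hang ha hb
  have heq : y = y' → y = p := fun he => by
    have := hin y t₁.right_mem.1 y (he ▸ t₂.right_mem.1)
    exact sub_eq_zero.1 (real_inner_self_nonpos.1 this)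
  by_cases hp : p ∈ T.carrier
  · have hv := not_mem_of_edgeLength_lt_dist (dist_comm v p ▸ h₁) hp
    have hw := not_mem_of_edgeLength_lt_dist h₂ hp
    refine covered_pair_of_exits ⟨hp, ⟨p, w⟩, by simp, Or.inl rfl⟩ (t₁.exits e hp hv)
      (t₂.exits rfl hp hw) heq fun m hm => ?_
    by_contra! hne
    obtain ⟨j, k, h⟩ := Frame.exists_of_index m
    have := h.inner_pos (p := p) (hm ▸ (T.coord_vertex_ne h.ij.symm).le)
      (hm ▸ (T.coord_vertex_ne h.ik.symm).le) t₁.right_mem.2 t₂.right_mem.2 hne.1 hne.2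
    exact absurd this (not_lt.2 (hin y t₁.right_mem.1 y' t₂.right_mem.1))
  · have hy := t₁.right_mem
    have hy' := t₂.right_mem
    obtain ⟨i, j, k, h, hi, hj, hk⟩ :=
      exists_frame_of_outside hp hy.2 hy'.2 (hin y hy.1 y' hy'.1)
    have hv : v ∉ T.carrier := fun hv => by
      have := dist_le_dist_of_inner_nonpos (hin v (right_mem_segment ℝ _ _) y' hy'.1)
      linarith [T.dist_le hv hy'.2]
    have hw : w ∉ T.carrier := fun hw => by
      have := dist_le_dist_of_inner_nonpos
        (real_inner_comm (y - p) (w - p) ▸ hin y hy.1 w (right_mem_segment ℝ _ _))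
      rw [dist_comm w p] at this
      linarith [T.dist_le hw hy.2]
    exact covered_of_outside h e rfl t₁ t₂ hi hj hk hv hw fun he => hp (heq he ▸ hy.2)

/-! ### Runs of a chain -/

variable {Γ : BoundaryChain}

/-- Of three consecutive segments the first and the last are too far apart to meet the same
triangle. -/
theorem not_meets_both (hΓ : Γ.GeometricProtocol T.edgeLength) {a : ℤ} (h0 : a ∈ Γ.index)
    (h1 : a + 1 ∈ Γ.index) (h2 : a + 2 ∈ Γ.index) (hm : T.Meets (Γ.side a))
    (hm' : T.Meets (Γ.side (a + 2))) : False := by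
  obtain ⟨x, hx, hxT⟩ := hm
  obtain ⟨y, hy, hyT⟩ := hm'
  have e : a + 1 + 1 = a + 2 := by ring
  have e' : a + 1 + 2 = a + 2 + 1 := by ring
  have a1 := inner_sub_nonpos_of_angle (hΓ.angular a h0 h1)
  have a2 := inner_sub_nonpos_of_angle (hΓ.angular (a + 1) h1 (e ▸ h2))
  rw [e, e'] at a2
  have hlen := hΓ.length (a + 1) h1
  rw [e] at hlen
  have hx' : x ∈ segment ℝ (Γ.vertex (a + 1)) (Γ.vertex a) := by rw [segment_symm]; exact hx
  have b1 := inner_sub_nonpos_of_mem a1 hx' (right_mem_segment ℝ _ _)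
  have b2 := inner_sub_nonpos_of_mem a2 (right_mem_segment ℝ _ _) hy
  have := dist_le_dist_of_inner_nonpos_of_inner_nonpos b1 b2
  linarith [T.dist_le hxT hyT]

theorem exists_isRun (hΓ : Γ.GeometricProtocol T.edgeLength) {i : ℤ} (hi : i ∈ Γ.index)
    (hm : T.Meets (Γ.side i)) : ∃ (a : ℤ) (m : ℕ), IsRun T Γ a m ∧ a ≤ i ∧ i < a + m := by
  have no : ∀ b c d : ℤ, c = b + 1 → d = b + 2 → (b ∈ Γ.index ∧ T.Meets (Γ.side b)) →
      (c ∈ Γ.index ∧ T.Meets (Γ.side c)) → (d ∈ Γ.index ∧ T.Meets (Γ.side d)) → False := by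
    rintro b _ _ rfl rfl hb hc hd
    exact not_meets_both hΓ hb.1 hc.1 hd.1 hb.2 hd.2
  by_cases hl : i - 1 ∈ Γ.index ∧ T.Meets (Γ.side (i - 1))
  · refine ⟨i - 1, 2, ⟨by norm_num, fun j h1 h2 => ?_, fun h => ?_, fun h => ?_⟩, by omega, by
      push_cast; omega⟩
    · push_cast at h2
      obtain rfl | rfl : j = i - 1 ∨ j = i := by omega
      exacts [hl, ⟨hi, hm⟩]
    · exact no _ _ _ (by ring) (by ring) h hl ⟨hi, hm⟩
    · exact no _ _ _ (by ring) (by push_cast; ring) hl ⟨hi, hm⟩ h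
  by_cases hr : i + 1 ∈ Γ.index ∧ T.Meets (Γ.side (i + 1))
  · refine ⟨i, 2, ⟨by norm_num, fun j h1 h2 => ?_, hl, fun h => ?_⟩, le_rfl, by
      push_cast; omega⟩
    · push_cast at h2
      obtain rfl | rfl : j = i ∨ j = i + 1 := by omega
      exacts [⟨hi, hm⟩, hr]
    · exact no _ _ _ rfl (by push_cast; ring) ⟨hi, hm⟩ hr h
  · refine ⟨i, 1, ⟨by norm_num, fun j h1 h2 => ?_, hl, by simpa using hr⟩, le_rfl, by
      push_cast; omega⟩
    push_cast at h2
    obtain rfl : j = i := by omega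
    exact ⟨hi, hm⟩

theorem IsRun.length_le (hΓ : Γ.GeometricProtocol T.edgeLength) {a : ℤ} {m : ℕ}
    (h : IsRun T Γ a m) : m = 1 ∨ m = 2 := by
  have := h.pos
  by_contra hne
  have h0 := h.meets a le_rfl (by omega)
  have h1 := h.meets (a + 1) (by omega) (by omega)
  have h2 := h.meets (a + 2) (by omega) (by omega)
  exact not_meets_both hΓ h0.1 h1.1 h2.1 h0.2 h2.2

theorem IsRun.covered (hΓ : Γ.GeometricProtocol T.edgeLength) {a : ℤ} {m : ℕ}
    (h : IsRun T Γ a m) : Covered T (configuration Γ a m) := by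
  rcases h.length_le hΓ with rfl | rfl
  · have h0 := h.meets a le_rfl (by norm_num)
    have e : configuration Γ a 1 = [Γ.side a] := by simp [configuration]
    rw [e]
    exact covered_of_single h0.2 (hΓ.length a h0.1)
  · have h0 := h.meets a le_rfl (by norm_num)
    have h1 := h.meets (a + 1) (by omega) (by push_cast; omega)
    have e : configuration Γ a 2 = [Γ.side a, Γ.side (a + 1)] := by
      simp [configuration, List.range_succ]
    have e' : a + 1 + 1 = a + 2 := by ring
    have hlen := hΓ.length (a + 1) h1.1
    have hm := h1.2
    rw [e]
    simp only [BoundaryChain.side] at hm ⊢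
    rw [e'] at hlen hm ⊢
    exact covered_of_pair h0.2 hm (inner_sub_nonpos_of_angle (hΓ.angular a h0.1 h1.1))
      (hΓ.length a h0.1) hlen

end Protocol

end SBMT

theorem theorem3p2 (T : SBMT.BaseTriangle) (Γ : SBMT.BoundaryChain)
    (hΓ : Γ.GeometricProtocol T.edgeLength) :
    (∀ i ∈ Γ.index, T.Meets (Γ.side i) →
      ∃ (a : ℤ) (m : ℕ), SBMT.IsRun T Γ a m ∧ a ≤ i ∧ i < a + m) ∧
    (∀ (a : ℤ) (m : ℕ), SBMT.IsRun T Γ a m →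
      (m = 1 ∨ m = 2) ∧
      SBMT.configurationType T (SBMT.configuration Γ a m) ∈ SBMT.canonicalTypes ∧
      ∃ τ ∈ SBMT.lookupTable,
        τ.type = SBMT.configurationType T (SBMT.configuration Γ a m) ∧
        τ.Retriangulates T (SBMT.configuration Γ a m)) ∧
    (∀ κ ∈ SBMT.canonicalTypes, ∃ τ ∈ SBMT.lookupTable, τ.type = κ) := by
  refine ⟨fun i hi hm => SBMT.exists_isRun hΓ hi hm,
    fun a m h => ⟨h.length_le hΓ, h.covered hΓ⟩, fun κ hκ => ?_⟩
  simp only [SBMT.canonicalTypes, List.mem_cons, List.not_mem_nil, or_false] at hκ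
  rcases hκ with rfl | rfl | rfl | rfl | rfl | rfl | rfl | rfl <;> simp [SBMT.lookupTable]
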